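/- Let $f=f_0+f_1u+\dots+f_mu^m\in\mathbb{Z}[u^{\pm1}]$, $m>0$, $f_m>0$, $f_0\neq0$, be irreducible, with set of complex roots $\Omega_f$. Put $\Omega_f^{-}=\{\omega\in\Omega_f:|\omega|<1\}$, $\Omega_f^{(0)}=\{\omega\in\Omega_f:|\omega|=1\}$, $\Omega_f^{+}=\{\omega\in\Omega_f:|\omega|>1\}$, and assume that $\Omega_f^{(0)}\neq\varnothing$ and that $\Omega_f^{(0)}$ contains no root of unity. *Notation.* Let $\bar\sigma$ be the shift $(\bar\sigma w)_n=w_{n+1}$ on two-sided sequences, $f(\bar\sigma)=\sum_k f_k\bar\sigma^k$, and let $\rho:\mathbb{R}^{\mathbb{Z}}\to\mathbb{T}^{\mathbb{Z}}$ (with $\mathbb{T}=\mathbb{R}/\mathbb{Z}$) be coordinatewise reduction modulo $1$. All sequence spaces carry the topology of coordinatewise convergence and its Borel $\sigma$-algebra. Let $X=\{x\in\mathbb{T}^{\mathbb{Z}}:\sum_n f_nx_{k+n}=0\text{ for all }k\in\mathbb{Z}\}$, let $\alpha$ be the restriction of the shift to $X$, let $\ell^\infty(\mathbb{Z},\mathbb{Z})$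 be the group of bounded two-sided integer sequences, $W_f^{(0)}=\{w\in\ell^\infty(\mathbb{Z},\mathbb{R}):f(\bar\sigma)w=0\}$ and $X^{(0)}=\rho(W_f^{(0)})\subset X$. Write $\frac1{f(u)}=\frac1{f_m}\sum_{\omega\in\Omega_f}\frac{b_\omega}{u-\omega}$ (partial fractions) and define $$w^{\Delta_+}_n=\begin{cases}\frac1{f_m}\sum_{\omega\in\Omega_f^-}b_\omega\omega^{n-1}&(n\ge1)\\-\frac1{f_m}\sum_{\omega\in\Omega_f^{(0)}\cup\Omega_f^+}b_\omega\omega^{n-1}&(n\le0)\end{cases}\qquad w^{\Delta_-}_n=\begin{cases}\frac1{f_m}\sum_{\omega\in\Omega_f^-\cup\Omega_f^{(0)}}b_\omega\omega^{n-1}&(n\ge1)\\-\frac1{f_m}\sum_{\omega\in\Omega_f^+}b_\omega\omega^{n-1}&(n\le0).\end{cases}$$ For $v\in\ell^\infty(\mathbb{Z},\mathbb{Z})$ let $\bar\xi^*(v)=\sum_{n\ge0}v_n\bar\sigma^{-n}w^{\Delta_-}+\sum_{n<0}v_n\bar\sigma^{-n}w^{\Delta_+}$ (coordinatewise convergent),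 $\xi^*(v)=\rho(\bar\xi^*(v))\in X$, and $\mathsf d(n,v)=\bar\sigma^n\bar\xi^*(v)-\bar\xi^*(\bar\sigma^nv)\in W_f^{(0)}$ for $n\in\mathbb{Z}$. Let $\tilde Y=\ell^\infty(\mathbb{Z},\mathbb{Z})\times W_f^{(0)}$, $\tilde\sigma(v,w)=(\bar\sigma v,\bar\sigma w+\mathsf d(1,v))$, and let $\tilde\pi:\tilde Y\to\ell^\infty(\mathbb{Z},\mathbb{Z})$ be the first coordinate projection. **Theorem.** For every $\bar\sigma$-invariant Borel probability measure $\nu$ on $\ell^\infty(\mathbb{Z},\mathbb{Z})$ the following conditions are equivalent. 1. There exists a $\tilde\sigma$-invariant probability measure $\tilde\nu$ on $\tilde Y$ with $\tilde\pi_*\tilde\nu=\nu$. 2. For every $\varepsilon>0$ there exists a compact set $C_\varepsilon\subset W_f^{(0)}$ with $\nu(\{v:\mathsf d(k,v)\in C_\varepsilon\})>1-\varepsilon$ for every $k\in\mathbb{Z}$. 3. There exists a Borel map $\mathsf b:\ell^\infty(\mathbb{Z},\mathbb{Z})\to W_f^{(0)}$ with $\mathsf d(1,v)=\mathsf b(\bar\sigma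 v)-\bar\sigma\mathsf b(v)$ for $\nu$-a.e. $v$. Moreover, for every Borel map $\mathsf b$ as in (3), the map $\xi^*_{\mathsf b}:\ell^\infty(\mathbb{Z},\mathbb{Z})\to X$, $\xi^*_{\mathsf b}(v)=\xi^*(v)+\rho(\mathsf b(v))$, is Borel and satisfies $\xi^*_{\mathsf b}(v)-\xi^*(v)\in X^{(0)}$ for every $v$ and $\xi^*_{\mathsf b}\circ\bar\sigma=\alpha\circ\xi^*_{\mathsf b}$ $\nu$-a.e., and the probability measure $\mu=(\xi^*_{\mathsf b})_*\nu$ on $X$ is $\alpha$-invariant. -/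

import Mathlib

open Polynomial MeasureTheory

noncomputable section

namespace NonexpansiveCoding

/-! ### Shifts and polynomials in the shift -/

/-- The `n`-th power of the shift on two-sided sequences: `(σⁿ w)_k = w_{k+n}`. -/
def shift {A : Type*} (n : ℤ) (w : ℤ → A) : ℤ → A := fun k => w (k + n)

/-- The group homomorphism `f(σ) = ∑_k f_k σᵏ` on two-sided sequences. -/
def polyShift {A : Type*} [AddCommGroup A] (f : ℤ[X]) : (ℤ → A) →+ (ℤ → A) where
  toFun w := fun n => ∑ k ∈ f.support, f.coeff k • w (n + k)
  map_zero' := by ext; simp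
  map_add' w w' := by ext; simp [Finset.sum_add_distrib]

lemma polyShift_apply {A : Type*} [AddCommGroup A] (f : ℤ[X]) (w : ℤ → A) (n : ℤ) :
    polyShift f w n = ∑ k ∈ f.support, f.coeff k • w (n + k) := rfl

lemma polyShift_shift {A : Type*} [AddCommGroup A] (f : ℤ[X]) (n : ℤ) (w : ℤ → A) :
    polyShift f (shift n w) = shift n (polyShift f w) := by
  ext k
  simp only [polyShift_apply, shift]
  refine Finset.sum_congr rfl fun i _ => ?_
  rw [add_right_comm]

/-! ### The sequence spaces

All sequence spaces are subtypes of products over `ℤ`; they carry the topology of coordinatewise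
convergence and the corresponding (Borel) product `σ`-algebra. -/

/-- `ℓ^∞(ℤ, ℤ)`: the bounded two-sided sequences of integers. -/
def BddIntSeq : AddSubgroup (ℤ → ℤ) where
  carrier := {v | ∃ C : ℤ, ∀ n, |v n| ≤ C}
  zero_mem' := ⟨0, by simp⟩
  add_mem' := by
    rintro v w ⟨C, hC⟩ ⟨D, hD⟩
    exact ⟨C + D, fun n => (abs_add_le _ _).trans (add_le_add (hC n) (hD n))⟩
  neg_mem' := by
    rintro v ⟨C, hC⟩
    exact ⟨C, fun n => by simpa using hC n⟩

/-- The `n`-th power of the shift on `ℓ^∞(ℤ, ℤ)`. -/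
def shiftInt (n : ℤ) (v : BddIntSeq) : BddIntSeq :=
  ⟨shift n v.1, by obtain ⟨C, hC⟩ := v.2; exact ⟨C, fun k => hC _⟩⟩

/-- `W_f^{(0)}`: the bounded real two-sided sequences `w` with `f(σ) w = 0`. -/
def W0 (f : ℤ[X]) : Submodule ℝ (ℤ → ℝ) where
  carrier := {w | (∃ C : ℝ, ∀ n, |w n| ≤ C) ∧ polyShift f w = 0}
  zero_mem' := ⟨⟨0, by simp⟩, map_zero _⟩
  add_mem' := by
    rintro v w ⟨⟨C, hC⟩, hv⟩ ⟨⟨D, hD⟩, hw⟩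
    exact ⟨⟨C + D, fun n => (abs_add_le _ _).trans (add_le_add (hC n) (hD n))⟩,
      by rw [map_add, hv, hw, add_zero]⟩
  smul_mem' := by
    rintro c w ⟨⟨C, hC⟩, hw⟩
    refine ⟨⟨|c| * C, fun n => ?_⟩, ?_⟩
    · simpa [abs_mul] using mul_le_mul_of_nonneg_left (hC n) (abs_nonneg c)
    · ext n
      have h := congrFun hw n
      simp only [polyShift_apply, Pi.zero_apply, zsmul_eq_mul, Pi.smul_apply, smul_eq_mul] at h ⊢
      rw [← mul_zero c, ← h, Finset.mul_sum]
      exact Finset.sum_congr rfl fun k _ => by ring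

lemma shift_mem_W0 {f : ℤ[X]} (n : ℤ) {w : ℤ → ℝ} (hw : w ∈ W0 f) : shift n w ∈ W0 f := by
  obtain ⟨⟨C, hC⟩, h⟩ := hw
  refine ⟨⟨C, fun k => hC _⟩, ?_⟩
  rw [polyShift_shift, h]
  rfl

/-- The shift on `W_f^{(0)}`. -/
def shiftW0 (f : ℤ[X]) (w : W0 f) : W0 f := ⟨shift 1 w.1, shift_mem_W0 1 w.2⟩

/-! ### The compact group `X` and its automorphism -/

/-- The compact group `X = ker f(τ) ⊆ 𝕋^ℤ`, where `τ` is the shift on `𝕋^ℤ`. -/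
def XGroup (f : ℤ[X]) : AddSubgroup (ℤ → UnitAddCircle) := (polyShift f).ker

/-- The automorphism `α` of `X`: the restriction of the shift `τ`. -/
def alpha (f : ℤ[X]) (x : XGroup f) : XGroup f :=
  ⟨shift 1 x.1, by
    have h : polyShift f x.1 = 0 := x.2
    change polyShift f (shift 1 x.1) = 0
    rw [polyShift_shift, h]
    rfl⟩

/-- Coordinatewise reduction modulo one, `ρ^* : ℝ^ℤ → 𝕋^ℤ`. -/
def rho : (ℤ → ℝ) →+ (ℤ → UnitAddCircle) where
  toFun w := fun n => (w n : UnitAddCircle)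
  map_zero' := by ext; simp
  map_add' w w' := by ext; simp

lemma polyShift_rho (f : ℤ[X]) (w : ℤ → ℝ) : polyShift f (rho w) = rho (polyShift f w) := by
  ext n
  change ∑ k ∈ f.support, f.coeff k • ((w (n + k) : ℝ) : UnitAddCircle)
    = ((∑ k ∈ f.support, f.coeff k • w (n + k) : ℝ) : UnitAddCircle)
  rw [← QuotientAddGroup.mk'_apply (AddSubgroup.zmultiples (1 : ℝ)), map_sum]
  exact Finset.sum_congr rfl fun k _ => ((QuotientAddGroup.mk' (AddSubgroup.zmultiples (1 : ℝ))).map_zsmul _ _).symm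

/-- The restriction of `ρ^*` to `W_f^{(0)}`, as a homomorphism into `X`. -/
def rhoW0 (f : ℤ[X]) : W0 f →+ XGroup f where
  toFun w := ⟨rho w.1, by
    change polyShift f (rho w.1) = 0
    rw [polyShift_rho, w.2.2, map_zero]⟩
  map_zero' := Subtype.ext (map_zero rho)
  map_add' w w' := Subtype.ext (map_add rho w.1 w'.1)

/-- The central subgroup `X^{(0)} = ρ(W_f^{(0)})` of `X`. -/
def X0 (f : ℤ[X]) : AddSubgroup (XGroup f) := (rhoW0 f).range

/-! ### The roots of `f` -/

/-- `Ω_f`: the set of complex roots of `f`. -/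
def Omega (f : ℤ[X]) : Finset ℂ := (f.aroots ℂ).toFinset

open Classical in
/-- `Ω_f^-`: the roots of absolute value less than one. -/
def OmegaNeg (f : ℤ[X]) : Finset ℂ := {ω ∈ Omega f | ‖ω‖ < 1}

open Classical in
/-- `Ω_f^{(0)}`: the roots of absolute value one. -/
def OmegaZero (f : ℤ[X]) : Finset ℂ := {ω ∈ Omega f | ‖ω‖ = 1}

open Classical in
/-- `Ω_f^+`: the roots of absolute value greater than one. -/
def OmegaPos (f : ℤ[X]) : Finset ℂ := {ω ∈ Omega f | 1 < ‖ω‖}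

/-- `f` is nonhyperbolic if it has a root of absolute value one. -/
def IsNonhyperbolic (f : ℤ[X]) : Prop := (OmegaZero f).Nonempty

/-- `f` is cyclotomic if one of its roots (of absolute value one) is a root of unity. -/
def IsCyclotomic (f : ℤ[X]) : Prop := ∃ ω ∈ OmegaZero f, ∃ n : ℕ, 0 < n ∧ ω ^ n = 1

/-- `f = f_0 + ⋯ + f_m u^m` is irreducible in the ring `ℤ[u, u⁻¹]` of Laurent polynomials and
normalized so that `m > 0`, `f_m > 0` and `f_0 ≠ 0`. -/
structure IsNormalizedIrreducible (f : ℤ[X]) : Prop where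
  irreducible : Irreducible (toLaurent f)
  natDegree_pos : 0 < f.natDegree
  leadingCoeff_pos : 0 < f.leadingCoeff
  coeff_zero_ne_zero : f.coeff 0 ≠ 0

/-! ### The fundamental solutions `w^{Δ₊}`, `w^{Δ₋}` and `w^{Δ₀}` -/

open Classical in
/-- The coefficient `b_ω` in the partial fraction decomposition
`1 / f(u) = (1 / f_m) ∑_{ω ∈ Ω_f} b_ω / (u - ω)`; see `partialFraction`. -/
def residue (f : ℤ[X]) (ω : ℂ) : ℂ := ∏ ω' ∈ (Omega f).erase ω, (ω - ω')⁻¹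

/-- `(1 / f_m) ∑_{ω ∈ S} b_ω ω^{n-1}`. -/
def expSum (f : ℤ[X]) (S : Finset ℂ) (n : ℤ) : ℂ :=
  (f.leadingCoeff : ℂ)⁻¹ * ∑ ω ∈ S, residue f ω * ω ^ (n - 1)

/-- `w^{Δ₊}`. The sums are real, as the sets of roots are stable under conjugation; the real part
only changes the type. -/
def wPlus (f : ℤ[X]) (n : ℤ) : ℝ :=
  if 1 ≤ n then (expSum f (OmegaNeg f) n).re
  else -(expSum f (OmegaZero f) n + expSum f (OmegaPos f) n).re

/-- `w^{Δ₋}`. -/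
def wMinus (f : ℤ[X]) (n : ℤ) : ℝ :=
  if 1 ≤ n then (expSum f (OmegaNeg f) n + expSum f (OmegaZero f) n).re
  else -(expSum f (OmegaPos f) n).re

/-- `w^{Δ₀}`. -/
def wZero (f : ℤ[X]) (n : ℤ) : ℝ := (expSum f (OmegaZero f) n).re

lemma wMinus_sub_wPlus (f : ℤ[X]) (n : ℤ) : wMinus f n - wPlus f n = wZero f n := by
  unfold wMinus wPlus wZero
  split_ifs <;> simp

lemma eval_of_mem_Omega {f : ℤ[X]} {ω : ℂ} (h : ω ∈ Omega f) :
    ∑ k ∈ f.support, (f.coeff k : ℂ) * ω ^ k = 0 := by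
  have h1 := (mem_aroots.1 (Multiset.mem_toFinset.1 h)).2
  rw [aeval_def, eval₂_eq_sum, Polynomial.sum] at h1
  simpa using h1

lemma sum_expSum {f : ℤ[X]} {S : Finset ℂ} (hS : S ⊆ Omega f) (h0 : ∀ ω ∈ S, ω ≠ 0) (n : ℤ) :
    ∑ k ∈ f.support, (f.coeff k : ℂ) * expSum f S (n + k) = 0 := by
  have h : ∀ k : ℕ, (f.coeff k : ℂ) * expSum f S (n + k) = (f.leadingCoeff : ℂ)⁻¹ *
      ∑ ω ∈ S, residue f ω * ω ^ (n - 1) * ((f.coeff k : ℂ) * ω ^ k) := by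
    intro k
    unfold expSum
    rw [mul_left_comm, Finset.mul_sum]
    congr 1
    refine Finset.sum_congr rfl fun ω hω => ?_
    rw [show n + k - 1 = (n - 1) + (k : ℤ) by ring, zpow_add₀ (h0 ω hω), zpow_natCast]
    ring
  simp_rw [h]
  rw [← Finset.mul_sum, Finset.sum_comm]
  simp_rw [← Finset.mul_sum]
  rw [Finset.sum_eq_zero (s := S), mul_zero]
  intro ω hω
  rw [eval_of_mem_Omega (hS hω), mul_zero]

lemma wZero_mem (f : ℤ[X]) : wZero f ∈ W0 f := by
  classical
  constructor
  · refine ⟨‖(f.leadingCoeff : ℂ)⁻¹‖ * ∑ ω ∈ OmegaZero f, ‖residue f ω‖, fun n => ?_⟩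
    refine (Complex.abs_re_le_norm _).trans ?_
    unfold expSum
    rw [norm_mul]
    refine mul_le_mul_of_nonneg_left ((norm_sum_le _ _).trans ?_) (norm_nonneg _)
    refine Finset.sum_le_sum fun ω hω => ?_
    have : ‖ω‖ = 1 := (Finset.mem_filter.1 hω).2
    simp [this]
  · ext n
    have h := sum_expSum (f := f) (S := OmegaZero f) (Finset.filter_subset _ _)
      (fun ω hω h => by
        have : ‖ω‖ = 1 := (Finset.mem_filter.1 hω).2
        simp [h] at this) n
    have h2 := congrArg Complex.re h
    rw [Complex.re_sum] at h2
    simpa [polyShift_apply, wZero, Complex.mul_re] using h2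

/-! ### The map `ξ̄^*` and the cocycle `d` -/

/-- The `k`-th coordinate of `σ^{-j} w^{Δ₋}` if `j ≥ 0`, of `σ^{-j} w^{Δ₊}` if `j < 0`. -/
def kernel (f : ℤ[X]) (j k : ℤ) : ℝ := if 0 ≤ j then wMinus f (k - j) else wPlus f (k - j)

/-- `ξ̄^*(v) = ∑_{j ≥ 0} v_j σ^{-j} w^{Δ₋} + ∑_{j < 0} v_j σ^{-j} w^{Δ₊}`, coordinatewise; see
`summable_kernel` for the convergence. -/
def xiBar (f : ℤ[X]) (v : BddIntSeq) : ℤ → ℝ := fun k => ∑' j : ℤ, (v.1 j : ℝ) * kernel f j k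

lemma summable_of_norm_lt {a : ℕ → ℝ} {C : ℝ} (ha : ∀ j, |a j| ≤ C) {z : ℂ} (hz : ‖z‖ < 1)
    (c : ℂ) : Summable fun j : ℕ => (a j : ℂ) * (c * z ^ j) := by
  refine Summable.of_norm_bounded (g := fun j => C * ‖c‖ * ‖z‖ ^ j)
    ((summable_geometric_of_lt_one (norm_nonneg z) hz).mul_left _) fun j => ?_
  rw [norm_mul, norm_mul, norm_pow, Complex.norm_real, Real.norm_eq_abs, mul_assoc]
  exact mul_le_mul_of_nonneg_right (ha j) (by positivity)

lemma summable_kernel (f : ℤ[X]) (v : BddIntSeq) (k : ℤ) :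
    Summable fun j : ℤ => (v.1 j : ℝ) * kernel f j k := by
  classical
  obtain ⟨C, hC⟩ := v.2
  have hC' : ∀ j, |(v.1 j : ℝ)| ≤ C := fun j => by exact_mod_cast hC j
  refine Summable.of_nat_of_neg ?_ ?_
  · have h : Summable fun j : ℕ => ((v.1 j : ℝ) : ℂ) * expSum f (OmegaPos f) (k - j) := by
      have : ∀ j : ℕ, ((v.1 j : ℝ) : ℂ) * expSum f (OmegaPos f) (k - j) =
          ∑ ω ∈ OmegaPos f, ((v.1 j : ℝ) : ℂ) *
            (((f.leadingCoeff : ℂ)⁻¹ * residue f ω * ω ^ (k - 1)) * (ω⁻¹) ^ j) := by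
        intro j
        unfold expSum
        rw [Finset.mul_sum, Finset.mul_sum]
        refine Finset.sum_congr rfl fun ω hω => ?_
        have h0 : ω ≠ 0 := by
          rintro rfl
          have := (Finset.mem_filter.1 hω).2
          simp at this
          linarith
        rw [show k - (j : ℤ) - 1 = (k - 1) + -(j : ℤ) by ring, zpow_add₀ h0, zpow_neg,
          zpow_natCast, inv_pow]
        ring
      simp_rw [this]
      refine summable_sum fun ω hω => summable_of_norm_lt (fun j => hC' _) ?_ _
      rw [norm_inv]
      exact inv_lt_one_of_one_lt₀ (Finset.mem_filter.1 hω).2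
    have h2 := ((Complex.reCLM.summable h).neg)
    refine h2.congr_atTop ?_
    filter_upwards [Filter.eventually_ge_atTop k.toNat] with j hj
    have h1 : ¬ 1 ≤ k - (j : ℤ) := by lia
    simp only [kernel, wMinus, Int.natCast_nonneg, if_true, if_neg h1, Complex.reCLM_apply,
      Complex.re_ofReal_mul]
    ring
  · set N : ℕ := k.natAbs + 1 with hN
    have h : Summable fun j : ℕ =>
        ((v.1 (-((j + N : ℕ) : ℤ)) : ℝ) : ℂ) * expSum f (OmegaNeg f) (k + (j + N : ℕ)) := by
      have : ∀ j : ℕ,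
          ((v.1 (-((j + N : ℕ) : ℤ)) : ℝ) : ℂ) * expSum f (OmegaNeg f) (k + (j + N : ℕ)) =
          ∑ ω ∈ OmegaNeg f, ((v.1 (-((j + N : ℕ) : ℤ)) : ℝ) : ℂ) *
            (((f.leadingCoeff : ℂ)⁻¹ * residue f ω * ω ^ (k + k.natAbs).toNat) * ω ^ j) := by
        intro j
        unfold expSum
        rw [Finset.mul_sum, Finset.mul_sum]
        refine Finset.sum_congr rfl fun ω hω => ?_
        rw [show k + ((j + N : ℕ) : ℤ) - 1 = (((k + k.natAbs).toNat + j : ℕ) : ℤ) by lia,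
          zpow_natCast, pow_add]
        ring
      simp_rw [this]
      exact summable_sum fun ω hω => summable_of_norm_lt (fun j => hC' _)
        (Finset.mem_filter.1 hω).2 _
    rw [← summable_nat_add_iff N]
    refine (Complex.reCLM.summable h).congr fun j => ?_
    by_cases hj : (0 : ℤ) ≤ -((j + N : ℕ) : ℤ)
    · lia
    have h1 : 1 ≤ k + ((j + N : ℕ) : ℤ) := by lia
    simp only [kernel, wPlus, if_neg hj, sub_neg_eq_add, if_pos h1, Complex.reCLM_apply,
      Complex.re_ofReal_mul]

/-- The sequence `σⁿ ξ̄^*(v) - ξ̄^*(σⁿ v)`. -/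
def dSeq (f : ℤ[X]) (n : ℤ) (v : BddIntSeq) : ℤ → ℝ :=
  shift n (xiBar f v) - xiBar f (shiftInt n v)

lemma dSeq_mem (f : ℤ[X]) (n : ℤ) (v : BddIntSeq) : dSeq f n v ∈ W0 f := by
  classical
  have key : dSeq f n v = ∑ j ∈ Finset.Ico (min 0 n) (max 0 n),
      ((if 0 ≤ j then 1 else -1) * (v.1 j : ℝ)) • shift (n - j) (wZero f) := by
    ext k
    have h1 : xiBar f (shiftInt n v) k = ∑' j : ℤ, (v.1 j : ℝ) * kernel f (j - n) k := by
      rw [← (Equiv.addRight n).tsum_eq]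
      simp [xiBar, shiftInt, shift]
    have h2 : Summable fun j : ℤ => (v.1 j : ℝ) * kernel f (j - n) k := by
      rw [← (Equiv.addRight n).summable_iff]
      simpa [Function.comp_def, shiftInt, shift] using summable_kernel f (shiftInt n v) k
    have h3 : dSeq f n v k = ∑' j : ℤ, ((v.1 j : ℝ) * kernel f j (k + n)
        - (v.1 j : ℝ) * kernel f (j - n) k) := by
      rw [(summable_kernel f v (k + n)).tsum_sub h2, ← h1]
      rfl
    rw [h3, tsum_eq_sum (s := Finset.Ico (min 0 n) (max 0 n)), Finset.sum_apply]
    · refine Finset.sum_congr rfl fun j hj => ?_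
      have hd := wMinus_sub_wPlus f (k + n - j)
      rw [Finset.mem_Ico] at hj
      simp only [kernel, Pi.smul_apply, shift, smul_eq_mul, ← hd,
        show k - (j - n) = k + n - j by ring, show k + (n - j) = k + n - j by ring]
      by_cases h0 : 0 ≤ j
      · have : ¬ 0 ≤ j - n := by lia
        simp only [if_pos h0, if_neg this]
        ring
      · have : 0 ≤ j - n := by lia
        simp only [if_neg h0, if_pos this]
        ring
    · intro j hj
      rw [Finset.mem_Ico] at hj
      have : (0 ≤ j) ↔ (0 ≤ j - n) := by lia
      simp only [kernel, this, show k - (j - n) = k + n - j by ring, sub_self]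
  rw [key]
  exact Submodule.sum_mem _ fun j _ => Submodule.smul_mem _ _ (shift_mem_W0 _ (wZero_mem f))

/-- The cocycle `d : ℤ × ℓ^∞(ℤ, ℤ) → W_f^{(0)}`, `d(n, v) = σⁿ ξ̄^*(v) - ξ̄^*(σⁿ v)`. -/
def cocycle (f : ℤ[X]) (n : ℤ) (v : BddIntSeq) : W0 f := ⟨dSeq f n v, dSeq_mem f n v⟩

/-- The space `Ỹ = ℓ^∞(ℤ, ℤ) × W_f^{(0)}`. -/
abbrev YTilde (f : ℤ[X]) : Type := BddIntSeq × W0 f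

/-- The map `σ̃(v, w) = (σ v, σ w + d(1, v))` of `Ỹ`. -/
def sigmaTilde (f : ℤ[X]) (y : YTilde f) : YTilde f :=
  (shiftInt 1 y.1, shiftW0 f y.2 + cocycle f 1 y.1)

/-! ### The map `ξ^*` takes values in `X` -/

lemma IsNormalizedIrreducible.irreducible_int {f : ℤ[X]} (hf : IsNormalizedIrreducible f) :
    Irreducible f := by
  have aux : ∀ g h : ℤ[X], f = g * h → IsUnit (toLaurent g) → IsUnit g := by
    intro g h hgh hu
    obtain ⟨q, hq⟩ := hu.exists_right_inv
    obtain ⟨n, q', hq'⟩ := LaurentPolynomial.exists_T_pow q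
    have h1 : g * q' = X ^ n := by
      apply toLaurent_injective
      rw [map_mul, hq', ← mul_assoc, hq, one_mul, toLaurent_X_pow]
    obtain ⟨i, -, hi⟩ := (dvd_prime_pow prime_X n).1 ⟨q', h1.symm⟩
    rcases Nat.eq_zero_or_pos i with rfl | hi0
    · simpa using hi.symm.isUnit isUnit_one
    · exfalso
      apply hf.coeff_zero_ne_zero
      rw [← X_dvd_iff, hgh]
      exact ((dvd_pow_self _ hi0.ne').trans hi.symm.dvd).mul_right _
  refine ⟨fun h => hf.irreducible.not_isUnit (h.map _), fun g h hgh => ?_⟩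
  rcases hf.irreducible.isUnit_or_isUnit (by rw [hgh, map_mul]) with h1 | h1
  · exact Or.inl (aux g h hgh h1)
  · exact Or.inr (aux h g (by rw [hgh, mul_comm]) h1)

lemma nodup_aroots {f : ℤ[X]} (hf : IsNormalizedIrreducible f) : (f.aroots ℂ).Nodup := by
  have hi := hf.irreducible_int
  have h1 := (IsPrimitive.Int.irreducible_iff_irreducible_map_cast
    (hi.isPrimitive hf.natDegree_pos.ne')).1 hi
  have h2 := (h1.separable.map (f := algebraMap ℚ ℂ))
  rw [Polynomial.map_map] at h2
  have h3 : (algebraMap ℚ ℂ).comp (Int.castRingHom ℚ) = algebraMap ℤ ℂ := RingHom.ext_int _ _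
  rw [h3] at h2
  exact nodup_roots h2

lemma card_aroots (f : ℤ[X]) : (f.aroots ℂ).card = f.natDegree :=
  IsAlgClosed.card_roots_map_eq_natDegree_of_injective _ (algebraMap ℤ ℂ).injective_int

lemma card_Omega {f : ℤ[X]} (hf : IsNormalizedIrreducible f) :
    (Omega f).card = f.natDegree := by
  rw [Omega, Multiset.toFinset_card_of_nodup (nodup_aroots hf), card_aroots]

lemma zero_notMem_Omega {f : ℤ[X]} (hf : IsNormalizedIrreducible f) : (0 : ℂ) ∉ Omega f := by
  intro h
  have h1 := (mem_aroots.1 (Multiset.mem_toFinset.1 h)).2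
  rw [← coeff_zero_eq_aeval_zero'] at h1
  exact hf.coeff_zero_ne_zero (by simpa using h1)

lemma partialFraction {f : ℤ[X]} (hf : IsNormalizedIrreducible f) {z : ℂ} (hz : z ∉ Omega f) :
    (aeval z f)⁻¹ = (f.leadingCoeff : ℂ)⁻¹ * ∑ ω ∈ Omega f, residue f ω / (z - ω) := by
  classical
  have hinj : Function.Injective (algebraMap ℤ ℂ) := (algebraMap ℤ ℂ).injective_int
  have h1 := C_leadingCoeff_mul_prod_multiset_X_sub_C (p := f.map (algebraMap ℤ ℂ))
    IsAlgClosed.card_roots_eq_natDegree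
  rw [leadingCoeff_map_of_injective hinj] at h1
  have h2 : ((f.map (algebraMap ℤ ℂ)).roots.map fun a => X - C a).prod =
      Lagrange.nodal (Omega f) id := by
    rw [Lagrange.nodal, Omega, Finset.prod_eq_multiset_prod, Multiset.toFinset_val,
      (nodup_aroots hf).dedup]
    rfl
  have h3 : aeval z f = (f.leadingCoeff : ℂ) * (Lagrange.nodal (Omega f) id).eval z := by
    rw [← h2, aeval_def, ← eval_map, ← h1, eval_mul, eval_C, h1]
    rfl
  have hne : (Omega f).Nonempty := by
    rw [← Finset.card_pos, card_Omega hf]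
    exact hf.natDegree_pos
  have h4 := Lagrange.eval_interpolate_not_at_node (s := Omega f) (v := id) (x := z) 1
    (fun ω hω h => hz (h ▸ hω))
  rw [Lagrange.interpolate_one (Set.injOn_id _) hne, eval_one] at h4
  rw [h3, mul_inv, inv_eq_of_mul_eq_one_right h4.symm]
  congr 1
  refine Finset.sum_congr rfl fun ω _ => ?_
  simp only [Lagrange.nodalWeight, residue, Pi.one_apply, mul_one, id, div_eq_mul_inv]

lemma sum_residue {f : ℤ[X]} (hf : IsNormalizedIrreducible f) {P : ℂ[X]}
    (hP : P.degree < f.natDegree) :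
    ∑ ω ∈ Omega f, residue f ω * P.eval ω = P.coeff (f.natDegree - 1) := by
  classical
  have h := Lagrange.coeff_eq_sum (s := Omega f) (v := id) (Set.injOn_id _) (P := P)
    (by rwa [card_Omega hf])
  rw [card_Omega hf] at h
  rw [h]
  refine Finset.sum_congr rfl fun ω _ => ?_
  rw [residue, Finset.prod_inv_distrib, mul_comm, div_eq_mul_inv]
  simp only [id]

lemma polyShift_wMinus {f : ℤ[X]} (hf : IsNormalizedIrreducible f) (n : ℤ) :
    polyShift f (wMinus f) n = if n = 0 then 1 else 0 := by
  classical
  have hlc : (f.leadingCoeff : ℂ) ≠ 0 := by exact_mod_cast hf.leadingCoeff_pos.ne'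
  have hsplit : ∀ n, wMinus f n =
      ((if 1 ≤ n then expSum f (Omega f) n else 0) - expSum f (OmegaPos f) n).re := by
    intro n
    have hsum : expSum f (Omega f) n =
        expSum f (OmegaNeg f) n + expSum f (OmegaZero f) n + expSum f (OmegaPos f) n := by
      unfold expSum OmegaNeg OmegaZero OmegaPos
      rw [← mul_add, ← mul_add, Finset.sum_filter, Finset.sum_filter, Finset.sum_filter,
        ← Finset.sum_add_distrib, ← Finset.sum_add_distrib]
      congr 1
      refine Finset.sum_congr rfl fun ω _ => ?_
      rcases lt_trichotomy ‖ω‖ 1 with h | h | h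
      · simp [h, h.ne, h.le.not_gt]
      · simp [h]
      · simp [h, h.ne', h.le.not_gt]
    unfold wMinus
    split_ifs with h
    · rw [hsum, add_sub_cancel_right]
    · simp
  have hpos := sum_expSum (f := f) (S := OmegaPos f) (Finset.filter_subset _ _)
    (fun ω hω h0 => zero_notMem_Omega hf (h0 ▸ (Finset.filter_subset _ _ hω))) n
  have hu : ∑ k ∈ f.support, (f.coeff k : ℂ) *
      (if 1 ≤ n + k then expSum f (Omega f) (n + k) else 0) = if n = 0 then 1 else 0 := by
    by_cases hn : 1 ≤ n
    · rw [if_neg (by lia), ← sum_expSum (f := f) (S := Omega f) subset_rfl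
        (fun ω hω h0 => zero_notMem_Omega hf (h0 ▸ hω)) n]
      exact Finset.sum_congr rfl fun k _ => by rw [if_pos (by lia)]
    · obtain ⟨N, rfl⟩ : ∃ N : ℕ, n = -N := ⟨n.natAbs, by lia⟩
      set P : ℂ[X] := ∑ k ∈ f.support with N + 1 ≤ k,
        Polynomial.monomial (k - (N + 1)) (f.coeff k : ℂ) with hPdef
      have hcoeff : ∀ i, P.coeff i = (f.coeff (i + (N + 1)) : ℂ) := by
        intro i
        simp only [hPdef, finsetSum_coeff, coeff_monomial]
        rw [Finset.sum_eq_single (i + (N + 1))]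
        · simp
        · intro k hk hne
          rw [Finset.mem_filter] at hk
          exact if_neg (by lia)
        · intro hk
          simp only [Finset.mem_filter, mem_support_iff, not_and, not_le] at hk
          have : f.coeff (i + (N + 1)) = 0 := by
            by_contra h
            have := hk h
            lia
          simp [this]
      have hdeg : P.degree < f.natDegree := by
        rw [degree_lt_iff_coeff_zero]
        intro i hi
        rw [hcoeff, coeff_eq_zero_of_natDegree_lt (by lia), Int.cast_zero]
      have hL := sum_residue hf hdeg
      rw [hcoeff] at hL
      have hm := hf.natDegree_pos
      have hval : ∑ k ∈ f.support, (f.coeff k : ℂ) *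
          (if 1 ≤ -(N : ℤ) + k then expSum f (Omega f) (-(N : ℤ) + k) else 0) =
          (f.leadingCoeff : ℂ)⁻¹ * ∑ ω ∈ Omega f, residue f ω * P.eval ω := by
        simp only [hPdef, eval_finsetSum, eval_monomial, Finset.mul_sum]
        rw [Finset.sum_comm' (t' := f.support.filter (N + 1 ≤ ·)) (s' := fun _ => Omega f)
          (by intros; tauto), Finset.sum_filter]
        refine Finset.sum_congr rfl fun k _ => ?_
        by_cases hk : N + 1 ≤ k
        · rw [if_pos (by lia), if_pos hk, expSum, mul_left_comm, Finset.mul_sum, Finset.mul_sum]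
          refine Finset.sum_congr rfl fun ω _ => ?_
          rw [show -(N : ℤ) + k - 1 = ((k - (N + 1) : ℕ) : ℤ) by lia, zpow_natCast]
          ring
        · rw [if_neg (by lia), if_neg hk, mul_zero]
      rw [hval, hL]
      by_cases hN : N = 0
      · subst hN
        rw [zero_add, Nat.sub_add_cancel hm, coeff_natDegree, inv_mul_cancel₀ hlc]
        simp
      · rw [coeff_eq_zero_of_natDegree_lt (by lia)]
        simp [hN]
  have h := congrArg Complex.re (congrArg₂ (· - ·) hu hpos)
  simp only [← Finset.sum_sub_distrib, ← mul_sub, sub_zero] at h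
  rw [Complex.re_sum] at h
  have hre : (if n = 0 then (1 : ℂ) else 0).re = if n = 0 then 1 else 0 := by
    split_ifs <;> simp
  rw [hre] at h
  rw [← h, polyShift_apply]
  refine Finset.sum_congr rfl fun k _ => ?_
  rw [hsplit, zsmul_eq_mul, ← Complex.ofReal_intCast, Complex.re_ofReal_mul]

lemma polyShift_wPlus {f : ℤ[X]} (hf : IsNormalizedIrreducible f) (n : ℤ) :
    polyShift f (wPlus f) n = if n = 0 then 1 else 0 := by
  have h : wPlus f = wMinus f - wZero f := by
    ext n
    rw [Pi.sub_apply, ← wMinus_sub_wPlus]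
    ring
  rw [h, map_sub, (wZero_mem f).2, sub_zero, polyShift_wMinus hf]

lemma polyShift_xiBar {f : ℤ[X]} (hf : IsNormalizedIrreducible f) (v : BddIntSeq) :
    polyShift f (xiBar f v) = fun n => (v.1 n : ℝ) := by
  ext n
  have h1 : polyShift f (xiBar f v) n = ∑' j : ℤ, ∑ k ∈ f.support,
      f.coeff k • ((v.1 j : ℝ) * kernel f j (n + k)) := by
    rw [Summable.tsum_finsetSum fun (k : ℕ) _ =>
      (summable_kernel f v (n + k)).const_smul (f.coeff k)]
    rw [polyShift_apply]
    refine Finset.sum_congr rfl fun k _ => ?_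
    simp only [zsmul_eq_mul, xiBar, tsum_mul_left]
  have h2 : ∀ j : ℤ, ∑ k ∈ f.support, f.coeff k • ((v.1 j : ℝ) * kernel f j (n + k)) =
      (v.1 j : ℝ) * if n = j then 1 else 0 := by
    intro j
    rw [Finset.sum_congr rfl fun (k : ℕ) _ =>
      (mul_smul_comm (f.coeff k) (v.1 j : ℝ) (kernel f j (n + k))).symm, ← Finset.mul_sum]
    congr 1
    unfold kernel
    by_cases hj : 0 ≤ j
    · have := polyShift_wMinus hf (n - j)
      simp only [if_pos hj, ← sub_eq_zero (a := n) (b := j), ← this, polyShift_apply]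
      exact Finset.sum_congr rfl fun k _ => by rw [add_sub_right_comm]
    · have := polyShift_wPlus hf (n - j)
      simp only [if_neg hj, ← sub_eq_zero (a := n) (b := j), ← this, polyShift_apply]
      exact Finset.sum_congr rfl fun k _ => by rw [add_sub_right_comm]
  rw [h1]
  simp_rw [h2]
  rw [tsum_eq_single n]
  · simp
  · intro j hj
    simp [hj.symm]

/-- `ξ^* = ρ^* ∘ ξ̄^* : ℓ^∞(ℤ, ℤ) → X`. -/
def xiStar {f : ℤ[X]} (hf : IsNormalizedIrreducible f) (v : BddIntSeq) : XGroup f :=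
  ⟨rho (xiBar f v), by
    change polyShift f (rho (xiBar f v)) = 0
    rw [polyShift_rho, polyShift_xiBar hf]
    ext n
    exact (AddCircle.coe_eq_zero_iff 1).2 ⟨v.1 n, by simp⟩⟩

/-- `ξ^*_b(v) = ξ^*(v) + ρ^*(b(v))` for a map `b : ℓ^∞(ℤ, ℤ) → W_f^{(0)}`. -/
def xiStarB {f : ℤ[X]} (hf : IsNormalizedIrreducible f) (b : BddIntSeq → W0 f)
    (v : BddIntSeq) : XGroup f := xiStar hf v + rhoW0 f (b v)

end NonexpansiveCoding

end

open NonexpansiveCoding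

/-!
(2) ⇒ (1): condition (2) is tightness of the laws of `d(k, ·)` under `ν`. The images of `ν ⊗ δ₀`
under the powers of `σ̃` are the laws of `v ↦ (σᵏ v, d(k, v))`; their Cesàro means are tight, and
every limit point is invariant and projects to `ν`.

(1) ⇒ (3): the fibre measures `κ_v` of `ν̃` over `ν` satisfy `κ_{σv} = (T_v)_* κ_v` almost
everywhere, where `T_v w = σ w + d(1, v)` is an affine isometry of `W_f^{(0)}` for the uniform
distance. Hence it suffices to choose measurably, and equivariantly under such isometries, a center
`b(v)` of `κ_v`. The barycenter need not exist. Instead one averages over the set of centers of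
those balls of radius `R` that carry more than half of the mass: two such balls always meet, so this
set is bounded, and the least natural number `R` for which it is not a null set is equivariant too.

(3) ⇒ (2): the cocycle equation gives `d(k, v) = b(σᵏ v) - σᵏ b(v)`, and the balls of `W_f^{(0)}`
for the uniform distance are shift invariant and compact in the topology of coordinatewise
convergence.
-/

namespace NonexpansiveCoding

open Filter ProbabilityTheory
open scoped Topology

/-! ### Tightness and invariant measures -/

lemma measurePreserving_map_of_ae_semiconj {α β : Type*} [MeasurableSpace α] [MeasurableSpace β]
    {μ : Measure α} {S : α → α} {T : β → β} {φ : α → β} (hS : MeasurePreserving S μ μ)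
    (hT : Measurable T) (hφ : Measurable φ) (h : ∀ᵐ a ∂μ, φ (S a) = T (φ a)) :
    MeasurePreserving T (μ.map φ) (μ.map φ) := by
  refine ⟨hT, ?_⟩
  have hcongr : T ∘ φ =ᵐ[μ] φ ∘ S := h.mono fun a ha => ha.symm
  rw [Measure.map_map hT hφ, Measure.map_congr hcongr, ← Measure.map_map hφ hS.measurable,
    hS.map_eq]

section Tightness

lemma exists_measure_compl_lt {α : Type*} [MeasurableSpace α] {μ : Measure α} [IsFiniteMeasure μ]
    {s : ℕ → Set α} (hs : ∀ m, NullMeasurableSet (s m) μ) (hmono : Monotone s)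
    (hcover : ∀ᵐ x ∂μ, ∃ m, x ∈ s m) {ε : ENNReal} (hε : 0 < ε) : ∃ m, μ (s m)ᶜ < ε := by
  have hlim := tendsto_measure_iInter_atTop (fun m => (hs m).compl)
    (fun i j hij => Set.compl_subset_compl.2 (hmono hij)) ⟨0, measure_ne_top μ _⟩
  have hnull : μ (⋂ m, (s m)ᶜ) = 0 :=
    measure_mono_null (fun x hx => by simpa using hx) (ae_iff.1 hcover)
  rw [hnull] at hlim
  exact (hlim.eventually_lt_const hε).exists

lemma isTightMeasureSet_range_map_iff {Ω E ι : Type*} [MeasurableSpace Ω] {ν : Measure Ω}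
    [IsProbabilityMeasure ν] [TopologicalSpace E] [T2Space E] [MeasurableSpace E]
    [OpensMeasurableSpace E] {φ : ι → Ω → E} (hφ : ∀ k, Measurable (φ k)) :
    IsTightMeasureSet (Set.range fun k => ν.map (φ k)) ↔
      ∀ ε : ℝ, 0 < ε → ∃ C : Set E, IsCompact C ∧ ∀ k, 1 - ε < ν.real {ω | φ k ω ∈ C} := by
  have hcompl : ∀ {C : Set E}, IsCompact C → ∀ k,
      ν.map (φ k) Cᶜ = ENNReal.ofReal (1 - ν.real {ω | φ k ω ∈ C}) := fun {C} hC k => by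
    have hmeas : MeasurableSet {ω | φ k ω ∈ C} := hφ k hC.measurableSet
    rw [Measure.map_apply (hφ k) hC.measurableSet.compl, ← probReal_compl_eq_one_sub hmeas,
      ofReal_measureReal]
    rfl
  rw [isTightMeasureSet_iff_exists_isCompact_measure_compl_le]
  simp only [Set.forall_mem_range]
  constructor
  · intro h ε hε
    obtain ⟨C, hC, hle⟩ := h (ENNReal.ofReal (ε / 2)) (ENNReal.ofReal_pos.2 (half_pos hε))
    refine ⟨C, hC, fun k => ?_⟩
    have hk := hle k
    rw [hcompl hC, ENNReal.ofReal_le_ofReal_iff (half_pos hε).le] at hk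
    linarith
  · intro h ε hε
    obtain ⟨δ, -, hδ, hδε⟩ := ENNReal.lt_iff_exists_real_btwn.1 hε
    obtain ⟨C, hC, hlt⟩ := h δ (ENNReal.ofReal_pos.1 hδ)
    refine ⟨C, hC, fun k => ?_⟩
    rw [hcompl hC]
    exact (ENNReal.ofReal_le_ofReal (by linarith [hlt k])).trans hδε.le

end Tightness

section CesaroMean

variable {E F : Type*} [MeasurableSpace E] [MeasurableSpace F]

/-- The Cesàro mean of the measures `μ 0, …, μ N`. -/
noncomputable def cesaroMean (μ : ℕ → Measure E) (N : ℕ) : Measure E :=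
  ((N + 1 : ℕ) : ENNReal)⁻¹ • ∑ n ∈ Finset.range (N + 1), μ n

lemma cesaroMean_apply (μ : ℕ → Measure E) (N : ℕ) (s : Set E) :
    cesaroMean μ N s = ((N + 1 : ℕ) : ENNReal)⁻¹ * ∑ n ∈ Finset.range (N + 1), μ n s := by
  simp [cesaroMean]

lemma cesaroMean_apply_le {μ : ℕ → Measure E} {s : Set E} {ε : ENNReal} (h : ∀ n, μ n s ≤ ε)
    (N : ℕ) : cesaroMean μ N s ≤ ε := by
  rw [cesaroMean_apply, ENNReal.inv_mul_le_iff (by simp) (ENNReal.natCast_ne_top _)]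
  refine (Finset.sum_le_sum fun n _ => h n).trans_eq ?_
  rw [Finset.sum_const, Finset.card_range, nsmul_eq_mul]

lemma cesaroMean_apply_const {μ : ℕ → Measure E} {s : Set E} {a : ENNReal} (h : ∀ n, μ n s = a)
    (N : ℕ) : cesaroMean μ N s = a := by
  rw [cesaroMean_apply, Finset.sum_congr rfl fun n _ => h n, Finset.sum_const, Finset.card_range,
    nsmul_eq_mul, ← mul_assoc, ENNReal.inv_mul_cancel (by simp) (ENNReal.natCast_ne_top _),
    one_mul]

instance (μ : ℕ → Measure E) [∀ n, IsProbabilityMeasure (μ n)] (N : ℕ) :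
    IsProbabilityMeasure (cesaroMean μ N) :=
  ⟨cesaroMean_apply_const (fun _ => measure_univ) N⟩

lemma map_cesaroMean_of_map_eq {μ : ℕ → Measure E} {ν : Measure F} {p : E → F}
    (hp : Measurable p) (hμ : ∀ n, (μ n).map p = ν) (N : ℕ) : (cesaroMean μ N).map p = ν := by
  ext s hs
  rw [Measure.map_apply hp hs]
  exact cesaroMean_apply_const (fun n => by rw [← hμ n, Measure.map_apply hp hs]) N

lemma isTightMeasureSet_range_cesaroMean [TopologicalSpace E] {μ : ℕ → Measure E}
    (h : IsTightMeasureSet (Set.range μ)) : IsTightMeasureSet (Set.range (cesaroMean μ)) := by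
  rw [isTightMeasureSet_iff_exists_isCompact_measure_compl_le] at h ⊢
  intro ε hε
  obtain ⟨K, hK, hle⟩ := h ε hε
  rw [Set.forall_mem_range] at hle
  exact ⟨K, hK, Set.forall_mem_range.2 fun N => cesaroMean_apply_le hle N⟩

lemma integral_cesaroMean {μ : ℕ → Measure E} {g : E → ℝ} (hg : ∀ n, Integrable g (μ n)) (N : ℕ) :
    ∫ x, g x ∂(cesaroMean μ N) =
      ((N + 1 : ℕ) : ℝ)⁻¹ * ∑ n ∈ Finset.range (N + 1), ∫ x, g x ∂(μ n) := by
  rw [cesaroMean, integral_smul_measure, integral_finsetSum_measure fun n _ => hg n,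
    ENNReal.toReal_inv, ENNReal.toReal_natCast, smul_eq_mul]

variable [TopologicalSpace E] [BorelSpace E]

lemma tendsto_integral_comp_sub_cesaroMean {T : E → E} (hT : Continuous T) {μ : ℕ → Measure E}
    [∀ n, IsProbabilityMeasure (μ n)] (hμ : ∀ n, μ (n + 1) = (μ n).map T)
    (g : BoundedContinuousFunction E ℝ) :
    Tendsto (fun N => ∫ x, g (T x) ∂(cesaroMean μ N) - ∫ x, g x ∂(cesaroMean μ N))
      atTop (𝓝 0) := by
  have hmap : ∀ n, ∫ x, g (T x) ∂(μ n) = ∫ x, g x ∂(μ (n + 1)) := fun n => by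
    rw [hμ, integral_map hT.aemeasurable g.continuous.aestronglyMeasurable]
  have htelescope : ∀ N, ∫ x, g (T x) ∂(cesaroMean μ N) - ∫ x, g x ∂(cesaroMean μ N) =
      ((N + 1 : ℕ) : ℝ)⁻¹ * (∫ x, g x ∂(μ (N + 1)) - ∫ x, g x ∂(μ 0)) := fun N => by
    have hgT : ∀ n, Integrable (fun x => g (T x)) (μ n) := fun n =>
      (g.compContinuous ⟨T, hT⟩).integrable (μ n)
    rw [integral_cesaroMean hgT, integral_cesaroMean fun n => g.integrable (μ n), ← mul_sub,
      ← Finset.sum_sub_distrib, Finset.sum_congr rfl fun n _ => congrArg (· - _) (hmap n),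
      Finset.sum_range_sub fun n => ∫ x, g x ∂(μ n)]
  have hbound : ∀ n, ‖∫ x, g x ∂(μ n)‖ ≤ ‖g‖ := fun n => by
    simpa using norm_integral_le_of_norm_le_const (μ := μ n) (ae_of_all _ g.norm_coe_le_norm)
  have hzero : Tendsto (fun N : ℕ => ((N + 1 : ℕ) : ℝ)⁻¹) atTop (𝓝 0) :=
    (tendsto_natCast_atTop_atTop.comp (tendsto_add_atTop_nat 1)).inv_tendsto_atTop
  simp only [htelescope]
  refine hzero.zero_mul_isBoundedUnder_le (isBoundedUnder_of ⟨‖g‖ + ‖g‖, fun N => ?_⟩)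
  exact (norm_sub_le _ _).trans (add_le_add (hbound (N + 1)) (hbound 0))

end CesaroMean

section KrylovBogoliubov

variable {E F : Type*} [MeasurableSpace E] [TopologicalSpace E] [BorelSpace E]
  [MeasurableSpace F] [TopologicalSpace F] [TopologicalSpace.MetrizableSpace F] [BorelSpace F]

lemma map_eq_of_tendsto {ι : Type*} {l : Filter ι} [l.NeBot] {p : E → F} (hp : Continuous p)
    {P : ι → ProbabilityMeasure E} {η : ProbabilityMeasure E} (hP : Tendsto P l (𝓝 η))
    {ν : Measure F} (hν : ∀ i, (P i : Measure E).map p = ν) : (η : Measure E).map p = ν := by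
  obtain ⟨i₀⟩ : Nonempty ι := l.nonempty_of_neBot
  have hmap := ProbabilityMeasure.tendsto_map_of_tendsto_of_continuous P η hP hp
  have hconst : ∀ i, (P i).map hp.aemeasurable = (P i₀).map hp.aemeasurable := fun i =>
    Subtype.ext ((hν i).trans (hν i₀).symm)
  simp only [hconst] at hmap
  exact (congrArg ProbabilityMeasure.toMeasure (tendsto_nhds_unique hmap tendsto_const_nhds)).trans
    (hν i₀)

variable [TopologicalSpace.MetrizableSpace E]

lemma exists_tendsto_ultrafilter_of_isTightMeasureSet {ι : Type*} {P : ι → ProbabilityMeasure E}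
    (h : IsTightMeasureSet (Set.range fun i => (P i : Measure E))) (l : Ultrafilter ι) :
    ∃ η, Tendsto P l (𝓝 η) := by
  have htight : IsTightMeasureSet {((η : ProbabilityMeasure E) : Measure E) | η ∈ Set.range P} := by
    convert h
    ext
    simp
  obtain ⟨η, -, hη⟩ := isCompact_iff_ultrafilter_le_nhds.1
    (isCompact_closure_of_isTightMeasureSet htight) (l.map P) <| by
      rw [Ultrafilter.coe_map, le_principal_iff, mem_map]
      exact univ_mem' fun i => subset_closure ⟨i, rfl⟩
  exact ⟨η, hη⟩

lemma measurePreserving_of_tendsto_integral_comp_sub {ι : Type*} {l : Filter ι} [l.NeBot]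
    {T : E → E} (hT : Continuous T) {P : ι → ProbabilityMeasure E} {η : ProbabilityMeasure E}
    (hP : Tendsto P l (𝓝 η))
    (hinv : ∀ g : BoundedContinuousFunction E ℝ,
      Tendsto (fun i => ∫ x, g (T x) ∂(P i : Measure E) - ∫ x, g x ∂(P i : Measure E)) l (𝓝 0)) :
    MeasurePreserving T (η : Measure E) η := by
  refine ⟨hT.measurable, ?_⟩
  have := Measure.isProbabilityMeasure_map (μ := (η : Measure E)) hT.aemeasurable
  refine ext_of_forall_integral_eq_of_IsFiniteMeasure fun g => ?_
  have hlim := ProbabilityMeasure.tendsto_iff_forall_integral_tendsto.1 hP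
  rw [integral_map hT.aemeasurable g.continuous.aestronglyMeasurable, ← sub_eq_zero]
  exact tendsto_nhds_unique ((hlim (g.compContinuous ⟨T, hT⟩)).sub (hlim g)) (hinv g)

theorem exists_measurePreserving_of_isTightMeasureSet {T : E → E} (hT : Continuous T)
    {p : E → F} (hp : Continuous p) {μ : ℕ → Measure E} [∀ n, IsProbabilityMeasure (μ n)]
    (hμ : ∀ n, μ (n + 1) = (μ n).map T) (htight : IsTightMeasureSet (Set.range μ))
    {ν : Measure F} (hν : ∀ n, (μ n).map p = ν) :
    ∃ η : Measure E, IsProbabilityMeasure η ∧ MeasurePreserving T η η ∧ η.map p = ν := by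
  let P : ℕ → ProbabilityMeasure E := fun N => ⟨cesaroMean μ N, inferInstance⟩
  obtain ⟨η, hη⟩ := exists_tendsto_ultrafilter_of_isTightMeasureSet (P := P)
    (isTightMeasureSet_range_cesaroMean htight) (hyperfilter ℕ)
  refine ⟨η, inferInstance, measurePreserving_of_tendsto_integral_comp_sub hT hη fun g => ?_,
    map_eq_of_tendsto hp hη (map_cesaroMean_of_map_eq hp.measurable hν)⟩
  exact (tendsto_integral_comp_sub_cesaroMean hT hμ g).mono_left Nat.hyperfilter_le_atTop

end KrylovBogoliubov

/-! ### Disintegration of invariant measures of skew products -/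

lemma ae_condKernel_map_eq {α β : Type*} [MeasurableSpace α] [MeasurableSpace β]
    [StandardBorelSpace β] [Nonempty β] {T : α ≃ᵐ α} {φ : α → β → β}
    (hφ : Measurable (Function.uncurry φ)) {ρ : Measure (α × β)} [IsFiniteMeasure ρ]
    (hρ : MeasurePreserving (fun y => (T y.1, φ y.1 y.2)) ρ ρ) :
    ∀ᵐ a ∂ρ.fst, ρ.condKernel (T a) = (ρ.condKernel a).map (φ a) := by
  have hT : MeasurePreserving T ρ.fst ρ.fst := ⟨T.measurable, by
    conv_rhs => rw [← hρ.map_eq]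
    rw [Measure.fst, Measure.fst, Measure.map_map T.measurable measurable_fst,
      Measure.map_map measurable_fst hρ.measurable]
    rfl⟩
  let κ : Kernel α β :=
    ((Kernel.id ×ₖ ρ.condKernel).map (Function.uncurry φ)).comap T.symm T.symm.measurable
  have hκ : ∀ a, κ (T a) = (ρ.condKernel a).map (φ a) := fun a => by
    rw [Kernel.comap_apply, T.symm_apply_apply, Kernel.map_apply _ hφ, Kernel.prod_apply,
      Kernel.id_apply, Measure.dirac_prod, Measure.map_map hφ measurable_prodMk_left]
    rfl
  have : IsMarkovKernel κ := by
    have := Kernel.IsMarkovKernel.map (Kernel.id ×ₖ ρ.condKernel) hφ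
    infer_instance
  have hρκ : ρ = ρ.fst ⊗ₘ κ := by
    ext s hs
    rw [← hρ.measure_preimage hs.nullMeasurableSet, Measure.compProd_apply hs,
      ← hT.lintegral_comp (Kernel.measurable_kernel_prodMk_left hs)]
    conv_lhs => rw [← ρ.disintegrate ρ.condKernel]
    rw [Measure.compProd_apply (hρ.measurable hs)]
    refine lintegral_congr fun a => ?_
    rw [hκ, Measure.map_apply hφ.of_uncurry_left (measurable_prodMk_left hs)]
    rfl
  filter_upwards [hT.quasiMeasurePreserving.ae (eq_condKernel_of_measure_eq_compProd κ hρκ)]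
    with a ha
  rw [← ha, hκ]

/-! ### Balls for the uniform distance -/

section SupBall

variable {ι A : Type*} [PseudoMetricSpace A]

/-- The closed ball of radius `R` around `w` for the uniform distance of functions `ι → A`. The
product topology is coarser, which is why these balls are compact when `A` is proper. -/
def supBall (R : ℝ) (w : ι → A) : Set (ι → A) := Set.univ.pi fun i => Metric.closedBall (w i) R

lemma mem_supBall {R : ℝ} {u w : ι → A} : u ∈ supBall R w ↔ ∀ i, dist (u i) (w i) ≤ R := by
  simp [supBall]

lemma mem_supBall_comm {R : ℝ} {u w : ι → A} : u ∈ supBall R w ↔ w ∈ supBall R u := by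
  simp only [mem_supBall, dist_comm]

lemma mem_supBall_trans {R S : ℝ} {u v w : ι → A} (huv : u ∈ supBall R v)
    (hvw : v ∈ supBall S w) : u ∈ supBall (R + S) w :=
  mem_supBall.2 fun i =>
    (dist_triangle _ (v i) _).trans (add_le_add (mem_supBall.1 huv i) (mem_supBall.1 hvw i))

lemma supBall_subset_supBall {R S : ℝ} (h : R ≤ S) (w : ι → A) : supBall R w ⊆ supBall S w :=
  Set.pi_mono fun _ _ => Metric.closedBall_subset_closedBall h

lemma isCompact_supBall [ProperSpace A] (R : ℝ) (w : ι → A) : IsCompact (supBall R w) :=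
  isCompact_univ_pi fun _ => isCompact_closedBall _ _

lemma isClosed_setOf_mem_supBall (R : ℝ) :
    IsClosed {p : (ι → A) × (ι → A) | p.2 ∈ supBall R p.1} := by
  simp only [mem_supBall, Set.ofPred_forall]
  exact isClosed_iInter fun i => isClosed_le (by fun_prop) continuous_const

lemma comp_mem_supBall {κ : Type*} {R : ℝ} {u w : ι → A} (h : u ∈ supBall R w) (g : κ → ι) :
    u ∘ g ∈ supBall R (w ∘ g) :=
  mem_supBall.2 fun i => mem_supBall.1 h (g i)

lemma sub_mem_supBall {E : Type*} [SeminormedAddCommGroup E] {R S : ℝ} {u w : ι → E}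
    (hu : u ∈ supBall R 0) (hw : w ∈ supBall S 0) : u - w ∈ supBall (R + S) 0 := by
  simp only [mem_supBall, Pi.zero_apply, dist_zero_right, Pi.sub_apply] at hu hw ⊢
  exact fun i => (norm_sub_le _ _).trans (add_le_add (hu i) (hw i))

end SupBall

/-! ### Centers of probability measures on spaces of functions -/

section HeavySet

variable {ι A : Type*} [PseudoMetricSpace A] [MeasurableSpace A]

/-- The set of centers of balls of radius `R` that carry more than half of the mass of a
probability measure `μ`. -/
def heavySet (μ : Measure (ι → A)) (R : ℝ) : Set (ι → A) := {w | 2⁻¹ < μ (supBall R w)}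

/-- The least natural number `R` for which `heavySet μ R` is not a null set. -/
noncomputable def centerRadius (μ : Measure (ι → A)) : ℕ :=
  sInf {R : ℕ | μ (heavySet μ R) ≠ 0}

variable [Countable ι] [OpensMeasurableSpace A]

lemma measurableSet_supBall (R : ℝ) (w : ι → A) : MeasurableSet (supBall R w) :=
  MeasurableSet.univ_pi fun _ => Metric.isClosed_closedBall.measurableSet

lemma mem_supBall_of_mem_heavySet {μ : Measure (ι → A)} [IsProbabilityMeasure μ] {R S : ℝ}
    {u w : ι → A} (hu : u ∈ heavySet μ R) (hw : w ∈ heavySet μ S) : u ∈ supBall (R + S) w := by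
  obtain ⟨z, hzu, hzw⟩ : (supBall R u ∩ supBall S w).Nonempty :=
    nonempty_inter_of_measure_lt_add μ (measurableSet_supBall S w) (Set.subset_univ _)
      (Set.subset_univ _) (by
        rw [measure_univ, ← ENNReal.inv_two_add_inv_two]
        exact ENNReal.add_lt_add hu hw)
  exact mem_supBall_trans (mem_supBall_comm.1 hzu) hzw

section Bounded

variable {μ : Measure (ι → A)} [IsProbabilityMeasure μ] {c : ι → A}

lemma exists_mem_heavySet (hμ : ∀ᵐ w ∂μ, ∃ m : ℕ, w ∈ supBall m c) :
    ∃ m : ℕ, c ∈ heavySet μ m := by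
  obtain ⟨m, hm⟩ := exists_measure_compl_lt
    (fun m : ℕ => (measurableSet_supBall (m : ℝ) c).nullMeasurableSet)
    (fun i j hij => supBall_subset_supBall (Nat.cast_le.2 hij) c) hμ (ε := 2⁻¹) (by simp)
  refine ⟨m, show 2⁻¹ < μ _ from not_le.1 fun hle => hm.not_ge ?_⟩
  rw [prob_compl_eq_one_sub (measurableSet_supBall _ c), ← ENNReal.one_sub_inv_two]
  exact tsub_le_tsub_left hle 1

lemma exists_measure_heavySet_ne_zero (hμ : ∀ᵐ w ∂μ, ∃ m : ℕ, w ∈ supBall m c) :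
    ∃ R : ℕ, μ (heavySet μ R) ≠ 0 := by
  obtain ⟨m, hm⟩ := exists_mem_heavySet hμ
  have hsub : supBall m c ⊆ heavySet μ (m + m : ℕ) := fun w hw => by
    refine hm.trans_le (measure_mono fun u hu => ?_)
    rw [Nat.cast_add]
    exact mem_supBall_trans hu (mem_supBall_comm.1 hw)
  exact ⟨m + m, (zero_le.trans_lt (hm.trans_le (measure_mono hsub))).ne'⟩

lemma measure_heavySet_centerRadius_ne_zero (hμ : ∀ᵐ w ∂μ, ∃ m : ℕ, w ∈ supBall m c) :
    μ (heavySet μ (centerRadius μ)) ≠ 0 :=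
  Nat.sInf_mem (exists_measure_heavySet_ne_zero hμ)

lemma exists_heavySet_subset_supBall (hμ : ∀ᵐ w ∂μ, ∃ m : ℕ, w ∈ supBall m c) (R : ℝ) :
    ∃ C, heavySet μ R ⊆ supBall C c := by
  obtain ⟨m, hm⟩ := exists_mem_heavySet hμ
  exact ⟨R + m, fun w hw => mem_supBall_of_mem_heavySet hw hm⟩

end Bounded

variable [SecondCountableTopology A]

lemma measurableSet_setOf_mem_heavySet {α : Type*} [MeasurableSpace α] (κ : Kernel α (ι → A))
    [IsSFiniteKernel κ] (R : ℝ) : MeasurableSet {p : α × (ι → A) | p.2 ∈ heavySet (κ p.1) R} := by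
  have hball : MeasurableSet {q : (α × (ι → A)) × (ι → A) | q.2 ∈ supBall R q.1.2} :=
    (measurable_snd.comp measurable_fst).prodMk measurable_snd
      (isClosed_setOf_mem_supBall R).measurableSet
  exact measurableSet_lt measurable_const
    (Kernel.measurable_kernel_prodMk_left (κ := κ.comap Prod.fst measurable_fst) hball)

lemma measurableSet_heavySet (μ : Measure (ι → A)) [SFinite μ] (R : ℝ) :
    MeasurableSet (heavySet μ R) :=
  measurable_prodMk_left (x := ()) (measurableSet_setOf_mem_heavySet (Kernel.const Unit μ) R)

lemma measurable_centerRadius {α : Type*} [MeasurableSpace α] (κ : Kernel α (ι → A))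
    [IsMarkovKernel κ] {c : ι → A} (hκ : ∀ a, ∀ᵐ w ∂κ a, ∃ m : ℕ, w ∈ supBall m c) :
    Measurable fun a => centerRadius (κ a) := by
  classical
  have hex := fun a => exists_measure_heavySet_ne_zero (hκ a)
  have hfind : (fun a => centerRadius (κ a)) = fun a => Nat.find (hex a) := by
    ext a
    refine (Nat.sInf_def (s := {R : ℕ | κ a (heavySet (κ a) R) ≠ 0}) (hex a)).trans ?_
    congr!
  rw [hfind]
  exact measurable_find hex fun R =>
    (Kernel.measurable_kernel_prodMk_left (measurableSet_setOf_mem_heavySet κ R))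
      (measurableSet_singleton 0).compl

end HeavySet

section Reindex

variable {ι E : Type*} [SeminormedAddCommGroup E]

/-- The isometric affine map `w ↦ w ∘ e + d` of `ι → E` for the uniform distance. -/
def reindexAdd (e : ι ≃ ι) (d w : ι → E) : ι → E := w ∘ e + d

lemma reindexAdd_apply (e : ι ≃ ι) (d w : ι → E) (i : ι) : reindexAdd e d w i = w (e i) + d i :=
  rfl

lemma reindexAdd_preimage_supBall (e : ι ≃ ι) (d w : ι → E) (R : ℝ) :
    reindexAdd e d ⁻¹' supBall R (reindexAdd e d w) = supBall R w := by
  ext u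
  simp only [Set.mem_preimage, mem_supBall, reindexAdd_apply, dist_add_right]
  exact e.forall_congr_right (q := fun i => dist (u i) (w i) ≤ R)

variable [MeasurableSpace E] [BorelSpace E]

lemma measurable_reindexAdd (e : ι ≃ ι) (d : ι → E) : Measurable (reindexAdd e d) :=
  measurable_pi_iff.2 fun i =>
    Measurable.add_const (f := fun w : ι → E => w (e i)) (measurable_pi_apply (e i)) (d i)

variable [Countable ι]

lemma reindexAdd_preimage_heavySet (e : ι ≃ ι) (d : ι → E) (μ : Measure (ι → E)) (R : ℝ) :
    reindexAdd e d ⁻¹' heavySet (μ.map (reindexAdd e d)) R = heavySet μ R := by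
  ext w
  simp only [Set.mem_preimage, heavySet, Set.mem_ofPred_eq]
  rw [Measure.map_apply (measurable_reindexAdd e d) (measurableSet_supBall _ _),
    reindexAdd_preimage_supBall]

variable [SecondCountableTopology E]

lemma map_reindexAdd_heavySet (e : ι ≃ ι) (d : ι → E) (μ : Measure (ι → E)) [SFinite μ] (R : ℝ) :
    μ.map (reindexAdd e d) (heavySet (μ.map (reindexAdd e d)) R) = μ (heavySet μ R) := by
  rw [Measure.map_apply (measurable_reindexAdd e d) (measurableSet_heavySet _ R),
    reindexAdd_preimage_heavySet]

lemma centerRadius_map_reindexAdd (e : ι ≃ ι) (d : ι → E) (μ : Measure (ι → E)) [SFinite μ] :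
    centerRadius (μ.map (reindexAdd e d)) = centerRadius μ := by
  simp only [centerRadius, map_reindexAdd_heavySet]

end Reindex

section Center

variable {ι E : Type*} [NormedAddCommGroup E] [MeasurableSpace E]

lemma integrableOn_heavySet [Countable ι] [BorelSpace E] [SecondCountableTopology E]
    {μ : Measure (ι → E)} [IsProbabilityMeasure μ] (hμ : ∀ᵐ w ∂μ, ∃ m : ℕ, w ∈ supBall m 0)
    (R : ℝ) (i : ι) : IntegrableOn (fun w : ι → E => w i) (heavySet μ R) μ := by
  obtain ⟨C, hC⟩ := exists_heavySet_subset_supBall hμ R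
  refine Measure.integrableOn_of_bounded (M := C) (measure_ne_top _ _)
    (measurable_pi_apply i).aestronglyMeasurable ?_
  refine (ae_restrict_iff' (measurableSet_heavySet μ R)).2 (ae_of_all _ fun w hw => ?_)
  simpa using mem_supBall.1 (hC hw) i

variable [NormedSpace ℝ E]

/-- The barycenter of the restriction of `μ` to `heavySet μ R`. -/
noncomputable def heavyMean (μ : Measure (ι → E)) (R : ℝ) (i : ι) : E :=
  ⨍ w in heavySet μ R, w i ∂μ

/-- A choice of a center for a probability measure `μ` on `ι → E` that is concentrated on bounded
functions. It depends measurably on `μ` and is natural under `reindexAdd`, unlike the barycenter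
of `μ`, which need not exist. -/
noncomputable def center (μ : Measure (ι → E)) : ι → E := heavyMean μ (centerRadius μ)

variable [BorelSpace E] [SecondCountableTopology E] [Countable ι]

section Kernel

variable {α : Type*} [MeasurableSpace α] (κ : Kernel α (ι → E))

lemma measurable_heavyMean [IsSFiniteKernel κ] (R : ℝ) :
    Measurable fun a => heavyMean (κ a) R := by
  refine measurable_pi_iff.2 fun i => ?_
  have hheavy := measurableSet_setOf_mem_heavySet κ R
  have hint : Measurable fun a => ∫ w in heavySet (κ a) R, w i ∂(κ a) := by
    have hcoord : StronglyMeasurable fun p : α × (ι → E) =>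
        {p : α × (ι → E) | p.2 ∈ heavySet (κ p.1) R}.indicator (fun p => p.2 i) p :=
      (((measurable_pi_apply i).comp measurable_snd).indicator hheavy).stronglyMeasurable
    simp only [← integral_indicator (measurableSet_heavySet (κ _) R)]
    exact (hcoord.integral_kernel_prod_right' (κ := κ)).measurable
  simp only [heavyMean, setAverage_eq]
  exact (Kernel.measurable_kernel_prodMk_left hheavy).ennreal_toReal.inv.smul hint

lemma measurable_center [IsMarkovKernel κ]
    (hκ : ∀ a, ∀ᵐ w ∂κ a, ∃ m : ℕ, w ∈ supBall m 0) : Measurable fun a => center (κ a) := by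
  have huncurry : Measurable fun p : α × ℕ => heavyMean (κ p.1) p.2 :=
    measurable_from_prod_countable_left fun R => measurable_heavyMean κ R
  have hcomp := huncurry.comp (measurable_id'.prodMk (measurable_centerRadius κ hκ))
  simpa only [center, Function.comp_def] using hcomp

end Kernel

section Bounded

variable [CompleteSpace E] {μ : Measure (ι → E)} [IsProbabilityMeasure μ]

lemma exists_center_mem_supBall (hμ : ∀ᵐ w ∂μ, ∃ m : ℕ, w ∈ supBall m 0) :
    ∃ C, center μ ∈ supBall C 0 := by
  obtain ⟨C, hC⟩ := exists_heavySet_subset_supBall hμ (centerRadius μ)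
  refine ⟨C, mem_supBall.2 fun i => ?_⟩
  refine (convex_closedBall (0 : E) C).set_average_mem Metric.isClosed_closedBall
    (measure_heavySet_centerRadius_ne_zero hμ) (measure_ne_top _ _) ?_
    (integrableOn_heavySet hμ _ i)
  exact (ae_restrict_iff' (measurableSet_heavySet μ _)).2
    (ae_of_all _ fun w hw => mem_supBall.1 (hC hw) i)

lemma center_map_reindexAdd (hμ : ∀ᵐ w ∂μ, ∃ m : ℕ, w ∈ supBall m 0)
    (e : ι ≃ ι) (d : ι → E) :
    center (μ.map (reindexAdd e d)) = reindexAdd e d (center μ) := by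
  ext i
  have hne : μ.real (heavySet μ (centerRadius μ)) ≠ 0 :=
    ENNReal.toReal_ne_zero.2 ⟨measure_heavySet_centerRadius_ne_zero hμ, measure_ne_top _ _⟩
  rw [reindexAdd_apply, center, center, centerRadius_map_reindexAdd, heavyMean, heavyMean,
    setAverage_eq, setAverage_eq, Measure.real, map_reindexAdd_heavySet, ← Measure.real,
    setIntegral_map (measurableSet_heavySet _ _) (measurable_pi_apply i).aestronglyMeasurable
      (measurable_reindexAdd e d).aemeasurable, reindexAdd_preimage_heavySet]
  simp only [reindexAdd_apply]
  rw [integral_add (integrableOn_heavySet hμ _ _) (integrable_const _), setIntegral_const,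
    smul_add, inv_smul_smul₀ hne]

end Bounded

lemma sum_smul_center_eq_zero {μ : Measure (ι → E)} [IsProbabilityMeasure μ]
    (hμ : ∀ᵐ w ∂μ, ∃ m : ℕ, w ∈ supBall m 0) {σ : Type*} {s : Finset σ} {c : σ → ℝ} {g : σ → ι}
    (hrel : ∀ᵐ w ∂μ, ∑ k ∈ s, c k • w (g k) = 0) : ∑ k ∈ s, c k • center μ (g k) = 0 := by
  have hint : ∀ k ∈ s, IntegrableOn (fun w => c k • w (g k)) (heavySet μ (centerRadius μ)) μ :=
    fun k _ => (integrableOn_heavySet hμ _ (g k)).smul (c k)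
  simp only [center, heavyMean, setAverage_eq, smul_comm (c _), ← integral_smul (c _),
    ← Finset.smul_sum]
  rw [← integral_finsetSum s hint, integral_eq_zero_of_ae (ae_restrict_of_ae hrel), smul_zero]

end Center

/-! ### The spaces of bounded sequences -/

section Spaces

variable {f : ℤ[X]}

instance : TopologicalSpace.MetrizableSpace BddIntSeq :=
  Topology.IsEmbedding.subtypeVal.metrizableSpace

instance : SecondCountableTopology (W0 f) :=
  Topology.IsEmbedding.subtypeVal.secondCountableTopology

lemma mem_BddIntSeq_iff {v : ℤ → ℤ} : v ∈ BddIntSeq ↔ ∃ m : ℕ, v ∈ supBall m 0 := by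
  simp only [mem_supBall, Pi.zero_apply, dist_zero_right, Int.norm_eq_abs]
  constructor
  · rintro ⟨C, hC⟩
    refine ⟨C.toNat, fun n => ?_⟩
    exact_mod_cast (hC n).trans (Int.self_le_toNat C)
  · rintro ⟨m, hm⟩
    exact ⟨m, fun n => by exact_mod_cast hm n⟩

lemma mem_W0_iff {w : ℤ → ℝ} :
    w ∈ W0 f ↔ (∃ m : ℕ, w ∈ supBall m 0) ∧ polyShift f w = 0 := by
  simp only [mem_supBall, Pi.zero_apply, dist_zero_right, Real.norm_eq_abs]
  refine and_congr_left fun _ => ⟨?_, fun ⟨m, hm⟩ => ⟨m, hm⟩⟩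
  rintro ⟨C, hC⟩
  obtain ⟨m, hm⟩ := exists_nat_ge C
  exact ⟨m, fun n => (hC n).trans hm⟩

lemma continuous_polyShift {A : Type*} [AddCommGroup A] [TopologicalSpace A]
    [IsTopologicalAddGroup A] (f : ℤ[X]) : Continuous (polyShift (A := A) f) := by
  refine continuous_pi fun n => ?_
  simp only [polyShift_apply]
  fun_prop

lemma isCompact_setOf_mem_supBall_BddIntSeq (R : ℝ) :
    IsCompact {v : BddIntSeq | v.1 ∈ supBall R 0} := by
  refine (Topology.IsInducing.subtypeVal.isCompact_preimage_iff fun v hv => ?_).2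
    (isCompact_supBall R 0)
  obtain ⟨m, hm⟩ := exists_nat_ge R
  exact ⟨⟨v, mem_BddIntSeq_iff.2 ⟨m, supBall_subset_supBall hm 0 hv⟩⟩, rfl⟩

lemma isCompact_setOf_mem_supBall_W0 (R : ℝ) : IsCompact {w : W0 f | w.1 ∈ supBall R 0} := by
  have hpreimage : {w : W0 f | w.1 ∈ supBall R 0} =
      Subtype.val ⁻¹' (supBall R 0 ∩ polyShift f ⁻¹' {0}) := by
    ext w
    simp [w.2.2]
  rw [hpreimage, Topology.IsInducing.subtypeVal.isCompact_preimage_iff]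
  · exact (isCompact_supBall R 0).inter_right
      (isClosed_singleton.preimage (continuous_polyShift f))
  · obtain ⟨m, hm⟩ := exists_nat_ge R
    exact fun w hw => ⟨⟨w, mem_W0_iff.2 ⟨⟨m, supBall_subset_supBall hm 0 hw.1⟩, hw.2⟩⟩, rfl⟩

lemma measurableSet_W0 : MeasurableSet (W0 f : Set (ℤ → ℝ)) := by
  have hW0 : (W0 f : Set (ℤ → ℝ)) = (⋃ m : ℕ, supBall m 0) ∩ polyShift f ⁻¹' {0} := by
    ext w
    simp [mem_W0_iff]
  rw [hW0]
  exact (MeasurableSet.iUnion fun m => measurableSet_supBall _ 0).inter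
    (isClosed_singleton.preimage (continuous_polyShift f)).measurableSet

instance : StandardBorelSpace (W0 f) := measurableSet_W0.standardBorel

lemma isTightMeasureSet_singleton_BddIntSeq (ν : Measure BddIntSeq) [IsFiniteMeasure ν] :
    IsTightMeasureSet {ν} := by
  rw [isTightMeasureSet_iff_exists_isCompact_measure_compl_le]
  intro ε hε
  obtain ⟨m, hm⟩ := exists_measure_compl_lt (μ := ν)
    (fun m : ℕ => (isCompact_setOf_mem_supBall_BddIntSeq m).measurableSet.nullMeasurableSet)
    (fun i j hij v hv => supBall_subset_supBall (Nat.cast_le.2 hij) 0 hv)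
    (ae_of_all _ fun v => mem_BddIntSeq_iff.1 v.2) hε
  exact ⟨_, isCompact_setOf_mem_supBall_BddIntSeq m, by rintro μ rfl; exact hm.le⟩

lemma center_mem_W0 {μ : Measure (ℤ → ℝ)} [IsProbabilityMeasure μ]
    (hμ : ∀ᵐ w ∂μ, w ∈ W0 f) : center μ ∈ W0 f := by
  have hbdd : ∀ᵐ w ∂μ, ∃ m : ℕ, w ∈ supBall m 0 := hμ.mono fun w hw => (mem_W0_iff.1 hw).1
  obtain ⟨C, hC⟩ := exists_center_mem_supBall hbdd
  obtain ⟨m, hm⟩ := exists_nat_ge C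
  refine mem_W0_iff.2 ⟨⟨m, supBall_subset_supBall hm 0 hC⟩, ?_⟩
  ext n
  simp only [polyShift_apply, Pi.zero_apply, ← Int.cast_smul_eq_zsmul ℝ]
  refine sum_smul_center_eq_zero hbdd (hμ.mono fun w hw => ?_)
  simpa only [polyShift_apply, Pi.zero_apply, ← Int.cast_smul_eq_zsmul ℝ] using congrFun hw.2 n

end Spaces

/-! ### The shift and the cocycle -/

section Cocycle

variable {f : ℤ[X]} {ν : Measure BddIntSeq}

lemma shiftInt_shiftInt (m n : ℤ) (v : BddIntSeq) :
    shiftInt m (shiftInt n v) = shiftInt (m + n) v := by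
  ext k
  simp only [shiftInt, shift, add_assoc]

lemma shiftInt_zero (v : BddIntSeq) : shiftInt 0 v = v := by
  ext k
  simp only [shiftInt, shift, add_zero]

lemma continuous_shiftInt (n : ℤ) : Continuous (shiftInt n) :=
  continuous_induced_rng.2
    (continuous_pi fun k => (continuous_apply (k + n)).comp continuous_subtype_val)

/-- The shift of `ℓ^∞(ℤ, ℤ)` as a measurable equivalence. -/
def shiftIntEquiv : BddIntSeq ≃ᵐ BddIntSeq where
  toFun := shiftInt 1
  invFun := shiftInt (-1)
  left_inv v := by rw [shiftInt_shiftInt, neg_add_cancel, shiftInt_zero]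
  right_inv v := by rw [shiftInt_shiftInt, add_neg_cancel, shiftInt_zero]
  measurable_toFun := (continuous_shiftInt 1).measurable
  measurable_invFun := (continuous_shiftInt (-1)).measurable

lemma measurePreserving_shiftInt (hν : MeasurePreserving (shiftInt 1) ν ν) (n : ℤ) :
    MeasurePreserving (shiftInt n) ν ν := by
  have hcomp : ∀ m n, shiftInt (m + n) = shiftInt m ∘ shiftInt n := fun m n => by
    ext1 v
    exact (shiftInt_shiftInt m n v).symm
  have hneg : MeasurePreserving (shiftInt (-1)) ν ν := MeasurePreserving.symm shiftIntEquiv hν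
  induction n with
  | zero =>
    rw [show shiftInt 0 = id from _root_.funext shiftInt_zero]
    exact MeasurePreserving.id ν
  | succ n ih => exact hcomp n 1 ▸ ih.comp hν
  | pred n ih => exact hcomp (-n) (-1) ▸ ih.comp hneg

lemma continuous_shiftW0 : Continuous (shiftW0 f) :=
  continuous_induced_rng.2
    (continuous_pi fun k => (continuous_apply (k + 1)).comp continuous_subtype_val)

lemma dSeq_add (m n : ℤ) (v : BddIntSeq) :
    dSeq f (m + n) v = shift m (dSeq f n v) + dSeq f m (shiftInt n v) := by
  ext k
  simp only [dSeq, shiftInt_shiftInt, Pi.add_apply, Pi.sub_apply, shift, add_assoc]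
  ring

lemma sigmaTilde_shiftInt_cocycle (n : ℤ) (v : BddIntSeq) :
    sigmaTilde f (shiftInt n v, cocycle f n v) = (shiftInt (1 + n) v, cocycle f (1 + n) v) :=
  Prod.ext (shiftInt_shiftInt 1 n v) (Subtype.ext (dSeq_add 1 n v).symm)

lemma kernel_sub_kernel_sub_one (j k : ℤ) :
    kernel f j (k + 1) - kernel f (j - 1) k = if j = 0 then wZero f (k + 1) else 0 := by
  rcases eq_or_ne j 0 with rfl | hj
  · simp [kernel, wMinus_sub_wPlus]
  · have hsign : 0 ≤ j - 1 ↔ 0 ≤ j := by lia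
    simp only [kernel, hsign, show k - (j - 1) = k + 1 - j by ring, sub_self, if_neg hj]

lemma cocycle_one (v : BddIntSeq) :
    cocycle f 1 v = (v.1 0 : ℝ) • ⟨shift 1 (wZero f), shift_mem_W0 1 (wZero_mem f)⟩ := by
  ext k
  have hxiBar : HasSum (fun j : ℤ => (v.1 j : ℝ) * kernel f (j - 1) k)
      (xiBar f (shiftInt 1 v) k) := by
    refine (Equiv.addRight (1 : ℤ)).hasSum_iff.1 ?_
    simp only [Function.comp_def, Equiv.coe_addRight, add_sub_cancel_right]
    exact (summable_kernel f (shiftInt 1 v) k).hasSum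
  have hdiff := (summable_kernel f v (k + 1)).hasSum.sub hxiBar
  simp only [← mul_sub, kernel_sub_kernel_sub_one, mul_ite, mul_zero] at hdiff
  exact (hdiff.unique (hasSum_single 0 fun j hj => if_neg hj)).trans (if_pos rfl)

lemma continuous_cocycle_one : Continuous (cocycle f 1) := by
  have hcoord : Continuous fun v : BddIntSeq => (v.1 0 : ℝ) :=
    continuous_of_discreteTopology.comp ((continuous_apply 0).comp continuous_subtype_val)
  exact (hcoord.smul continuous_const).congr fun v => (cocycle_one v).symm

lemma continuous_sigmaTilde : Continuous (sigmaTilde f) :=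
  ((continuous_shiftInt 1).comp continuous_fst).prodMk
    ((continuous_shiftW0.comp continuous_snd).add (continuous_cocycle_one.comp continuous_fst))

lemma measurable_xiBar : Measurable (xiBar f) := by
  refine measurable_pi_iff.2 fun k => ?_
  have hpartial : ∀ s : Finset ℤ, Measurable fun v : BddIntSeq =>
      ∑ j ∈ s, (v.1 j : ℝ) * kernel f j k := fun s => by
    refine Finset.measurable_sum _ fun j _ => Measurable.mul_const ?_ _
    exact measurable_from_top.comp ((measurable_pi_apply j).comp measurable_subtype_coe)
  exact measurable_of_tendsto_metrizable' atTop hpartial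
    (tendsto_pi_nhds.2 fun v => (summable_kernel f v k).hasSum)

lemma measurable_shift {A : Type*} [MeasurableSpace A] (n : ℤ) :
    Measurable (shift n : (ℤ → A) → ℤ → A) :=
  measurable_pi_iff.2 fun k => measurable_pi_apply (k + n)

lemma measurable_cocycle (n : ℤ) : Measurable (cocycle f n) :=
  (((measurable_shift n).comp measurable_xiBar).sub
    (measurable_xiBar.comp (continuous_shiftInt n).measurable)).subtype_mk

end Cocycle

/-! ### Measures on the skew product -/

section SkewProduct

variable {f : ℤ[X]} {ν : Measure BddIntSeq} [IsProbabilityMeasure ν]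

theorem exists_measurePreserving_sigmaTilde (hν : MeasurePreserving (shiftInt 1) ν ν)
    (htight : IsTightMeasureSet (Set.range fun k => ν.map (cocycle f k))) :
    ∃ νt : Measure (YTilde f), IsProbabilityMeasure νt ∧
      MeasurePreserving (sigmaTilde f) νt νt ∧ νt.map Prod.fst = ν := by
  have hmeas : ∀ n, Measurable fun v => (shiftInt n v, cocycle f n v) := fun n =>
    (continuous_shiftInt n).measurable.prodMk (measurable_cocycle n)
  let μ : ℕ → Measure (YTilde f) := fun n => ν.map fun v => (shiftInt n v, cocycle f n v)
  have : ∀ n, IsProbabilityMeasure (μ n) := fun n =>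
    Measure.isProbabilityMeasure_map (hmeas n).aemeasurable
  have hsucc : ∀ n, μ (n + 1) = (μ n).map (sigmaTilde f) := fun n => by
    rw [Measure.map_map continuous_sigmaTilde.measurable (hmeas n)]
    simp only [μ, Function.comp_def, sigmaTilde_shiftInt_cocycle, Nat.cast_add, Nat.cast_one,
      add_comm]
  have hfst : ∀ n, (μ n).map Prod.fst = ν := fun n => by
    rw [Measure.map_map measurable_fst (hmeas n)]
    exact (measurePreserving_shiftInt hν n).map_eq
  have hsnd : ∀ n, (μ n).map Prod.snd = ν.map (cocycle f n) := fun n =>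
    Measure.map_map measurable_snd (hmeas n)
  refine exists_measurePreserving_of_isTightMeasureSet continuous_sigmaTilde continuous_fst hsucc
    (IsTightMeasureSet.prodMk ?_ ?_) hfst
  · refine (isTightMeasureSet_singleton_BddIntSeq ν).subset ?_
    rintro _ ⟨_, ⟨n, rfl⟩, rfl⟩
    exact hfst n
  · refine htight.subset ?_
    rintro _ ⟨_, ⟨n, rfl⟩, rfl⟩
    exact ⟨n, (hsnd n).symm⟩

theorem exists_coboundary_of_measurePreserving_sigmaTilde {νt : Measure (YTilde f)}
    [IsProbabilityMeasure νt] (hνt : MeasurePreserving (sigmaTilde f) νt νt) :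
    ∃ b : BddIntSeq → W0 f, Measurable b ∧
      ∀ᵐ v ∂νt.map Prod.fst, cocycle f 1 v = b (shiftInt 1 v) - shiftW0 f (b v) := by
  let κ : Kernel BddIntSeq (ℤ → ℝ) := νt.condKernel.map Subtype.val
  have : IsMarkovKernel κ := Kernel.IsMarkovKernel.map _ measurable_subtype_coe
  have hκ : ∀ v, κ v = (νt.condKernel v).map Subtype.val :=
    Kernel.map_apply _ measurable_subtype_coe
  have hmem : ∀ v, ∀ᵐ w ∂κ v, w ∈ W0 f := fun v => by
    rw [hκ]
    exact (ae_map_iff measurable_subtype_coe.aemeasurable measurableSet_W0).2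
      (ae_of_all _ Subtype.property)
  have hbdd : ∀ v, ∀ᵐ w ∂κ v, ∃ m : ℕ, w ∈ supBall m 0 := fun v =>
    (hmem v).mono fun w hw => (mem_W0_iff.1 hw).1
  refine ⟨fun v => ⟨center (κ v), center_mem_W0 (hmem v)⟩,
    (measurable_center κ hbdd).subtype_mk, ?_⟩
  have hequiv := ae_condKernel_map_eq (T := shiftIntEquiv)
    (φ := fun v w => shiftW0 f w + cocycle f 1 v) continuous_sigmaTilde.measurable.snd hνt
  filter_upwards [hequiv] with v hv
  have hshift : κ (shiftInt 1 v) =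
      (κ v).map (reindexAdd (Equiv.addRight 1) (cocycle f 1 v).1) := by
    rw [hκ, hκ, Measure.map_map (measurable_reindexAdd _ _) measurable_subtype_coe]
    refine (congrArg (Measure.map Subtype.val) hv).trans (Measure.map_map measurable_subtype_coe ?_)
    exact (continuous_shiftW0.add continuous_const).measurable
  refine eq_sub_of_add_eq' (Subtype.ext ?_)
  simp only [hshift, center_map_reindexAdd (hbdd v)]
  rfl

end SkewProduct

/-! ### The coboundary equation -/

section Coboundary

variable {f : ℤ[X]} {ν : Measure BddIntSeq} {b : BddIntSeq → W0 f}

lemma ae_forall_shiftInt_eq {A : Type*} {φ : BddIntSeq → ℤ → A}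
    (hν : MeasurePreserving (shiftInt 1) ν ν)
    (hφ : ∀ᵐ v ∂ν, φ (shiftInt 1 v) = shift 1 (φ v)) :
    ∀ᵐ v ∂ν, ∀ k, φ (shiftInt k v) = shift k (φ v) := by
  have horbit : ∀ᵐ v ∂ν, ∀ k, φ (shiftInt (1 + k) v) = shift 1 (φ (shiftInt k v)) :=
    ae_all_iff.2 fun k => by
      simpa only [shiftInt_shiftInt] using
        (measurePreserving_shiftInt hν k).quasiMeasurePreserving.ae hφ
  filter_upwards [horbit] with v hv k
  induction k with
  | zero =>
    ext n
    simp only [shiftInt_zero, shift, add_zero]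
  | succ k ih =>
    rw [add_comm (k : ℤ), hv, ih]
    ext n
    simp only [shift, add_assoc]
  | pred k ih =>
    have hstep := hv (-k - 1)
    rw [add_sub_cancel, ih] at hstep
    ext n
    have := congrFun hstep (n - 1)
    simp only [shift, sub_add_cancel] at this ⊢
    rw [← this]
    ring_nf

lemma dSeq_eq_sub_shift_iff {n : ℤ} {v : BddIntSeq} {u w : ℤ → ℝ} :
    dSeq f n v = u - shift n w ↔ xiBar f (shiftInt n v) + u = shift n (xiBar f v + w) := by
  rw [dSeq, sub_eq_sub_iff_add_eq_add, eq_comm, add_comm u]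
  rfl

lemma cocycle_one_eq_sub_iff {v : BddIntSeq} {u w : W0 f} :
    cocycle f 1 v = u - shiftW0 f w ↔
      xiBar f (shiftInt 1 v) + u.1 = shift 1 (xiBar f v + w.1) :=
  Subtype.ext_iff.trans dSeq_eq_sub_shift_iff

lemma ae_cocycle_eq (hν : MeasurePreserving (shiftInt 1) ν ν)
    (hcob : ∀ᵐ v ∂ν, cocycle f 1 v = b (shiftInt 1 v) - shiftW0 f (b v)) :
    ∀ᵐ v ∂ν, ∀ k, (cocycle f k v).1 = (b (shiftInt k v)).1 - shift k (b v).1 := by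
  have hshift := ae_forall_shiftInt_eq (φ := fun v => xiBar f v + (b v).1) hν
    (hcob.mono fun v => cocycle_one_eq_sub_iff.1)
  exact hshift.mono fun v hv k => dSeq_eq_sub_shift_iff.2 (hv k)

theorem isTightMeasureSet_range_map_cocycle [IsFiniteMeasure ν]
    (hν : MeasurePreserving (shiftInt 1) ν ν) (hb : Measurable b)
    (hcob : ∀ᵐ v ∂ν, cocycle f 1 v = b (shiftInt 1 v) - shiftW0 f (b v)) :
    IsTightMeasureSet (Set.range fun k => ν.map (cocycle f k)) := by
  rw [isTightMeasureSet_iff_exists_isCompact_measure_compl_le]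
  intro ε hε
  let B : ℕ → Set BddIntSeq := fun m => {v | (b v).1 ∈ supBall m 0}
  have hB : ∀ m, MeasurableSet (B m) := fun m =>
    hb.subtype_val (measurableSet_supBall m 0)
  obtain ⟨m, hm⟩ := exists_measure_compl_lt (μ := ν) (fun m => (hB m).nullMeasurableSet)
    (fun i j hij v hv => supBall_subset_supBall (Nat.cast_le.2 hij) 0 hv)
    (ae_of_all _ fun v => (mem_W0_iff.1 (b v).2).1) (ENNReal.half_pos hε.ne')
  have hC := isCompact_setOf_mem_supBall_W0 (f := f) (m + m)
  refine ⟨_, hC, Set.forall_mem_range.2 fun k => ?_⟩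
  rw [Measure.map_apply (measurable_cocycle k) hC.measurableSet.compl]
  calc ν (cocycle f k ⁻¹' {w : W0 f | w.1 ∈ supBall (m + m) 0}ᶜ)
      ≤ ν (shiftInt k ⁻¹' (B m)ᶜ ∪ (B m)ᶜ) := by
        refine measure_mono_ae ((ae_cocycle_eq hν hcob).mono fun v hv hout => ?_)
        by_contra hin
        obtain ⟨hshift, hv₀⟩ := not_or.1 hin
        refine hout ?_
        change (cocycle f k v).1 ∈ supBall (m + m) 0
        rw [hv k]
        exact sub_mem_supBall (not_not.1 hshift) (comp_mem_supBall (not_not.1 hv₀) (· + k))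
    _ ≤ ν (shiftInt k ⁻¹' (B m)ᶜ) + ν (B m)ᶜ := measure_union_le _ _
    _ = ν (B m)ᶜ + ν (B m)ᶜ := by
        rw [(measurePreserving_shiftInt hν k).measure_preimage (hB m).compl.nullMeasurableSet]
    _ ≤ ε := (add_le_add hm.le hm.le).trans_eq (ENNReal.add_halves ε)

lemma measurable_rho : Measurable rho :=
  measurable_pi_iff.2 fun n =>
    (AddCircle.continuous_mk' (1 : ℝ)).measurable.comp (measurable_pi_apply n)

lemma measurable_alpha : Measurable (alpha f) :=
  ((measurable_shift 1).comp measurable_subtype_coe).subtype_mk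

variable (hf : IsNormalizedIrreducible f)

lemma coe_xiStarB (v : BddIntSeq) : (xiStarB hf b v).1 = rho (xiBar f v + (b v).1) :=
  (map_add rho _ _).symm

lemma measurable_xiStarB (hb : Measurable b) : Measurable (xiStarB hf b) := by
  refine measurable_comap_iff.2 ?_
  change Measurable fun v => (xiStarB hf b v).1
  simp only [coe_xiStarB]
  exact measurable_rho.comp (measurable_xiBar.add hb.subtype_val)

lemma xiStarB_sub_xiStar_mem_X0 (v : BddIntSeq) : xiStarB hf b v - xiStar hf v ∈ X0 f :=
  ⟨b v, (add_sub_cancel_left _ _).symm⟩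

lemma ae_xiStarB_shiftInt
    (hcob : ∀ᵐ v ∂ν, cocycle f 1 v = b (shiftInt 1 v) - shiftW0 f (b v)) :
    ∀ᵐ v ∂ν, xiStarB hf b (shiftInt 1 v) = alpha f (xiStarB hf b v) := by
  filter_upwards [hcob] with v hv
  refine Subtype.ext ?_
  change (xiStarB hf b (shiftInt 1 v)).1 = shift 1 (xiStarB hf b v).1
  rw [coe_xiStarB, coe_xiStarB, cocycle_one_eq_sub_iff.1 hv]
  rfl

end Coboundary

end NonexpansiveCoding

theorem theoremt_general (f : ℤ[X]) (hf : IsNormalizedIrreducible f)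
    (ν : Measure BddIntSeq) [IsProbabilityMeasure ν] (hν : MeasurePreserving (shiftInt 1) ν ν) :
    List.TFAE [
      ∃ νt : Measure (YTilde f), IsProbabilityMeasure νt ∧
        MeasurePreserving (sigmaTilde f) νt νt ∧ νt.map Prod.fst = ν,
      ∀ ε : ℝ, 0 < ε → ∃ C : Set (W0 f), IsCompact C ∧
        ∀ k : ℤ, 1 - ε < ν.real {v | cocycle f k v ∈ C},
      ∃ b : BddIntSeq → W0 f, Measurable b ∧
        ∀ᵐ v ∂ν, cocycle f 1 v = b (shiftInt 1 v) - shiftW0 f (b v)] ∧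
    ∀ b : BddIntSeq → W0 f, Measurable b →
      (∀ᵐ v ∂ν, cocycle f 1 v = b (shiftInt 1 v) - shiftW0 f (b v)) →
      Measurable (xiStarB hf b) ∧
      (∀ v, xiStarB hf b v - xiStar hf v ∈ X0 f) ∧
      (∀ᵐ v ∂ν, xiStarB hf b (shiftInt 1 v) = alpha f (xiStarB hf b v)) ∧
      IsProbabilityMeasure (ν.map (xiStarB hf b)) ∧
      MeasurePreserving (alpha f) (ν.map (xiStarB hf b)) (ν.map (xiStarB hf b)) := by
  constructor
  · rw [← isTightMeasureSet_range_map_iff measurable_cocycle]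
    tfae_have 2 → 1 := exists_measurePreserving_sigmaTilde hν
    tfae_have 1 → 3 := by
      rintro ⟨νt, _, hνt, rfl⟩
      exact exists_coboundary_of_measurePreserving_sigmaTilde hνt
    tfae_have 3 → 2 := fun ⟨_, hb, hcob⟩ => isTightMeasureSet_range_map_cocycle hν hb hcob
    tfae_finish
  · intro b hb hcob
    have hmeas := measurable_xiStarB hf hb
    have hequiv := ae_xiStarB_shiftInt hf hcob
    exact ⟨hmeas, xiStarB_sub_xiStar_mem_X0 hf, hequiv,
      Measure.isProbabilityMeasure_map hmeas.aemeasurable,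
      measurePreserving_map_of_ae_semiconj hν measurable_alpha hmeas hequiv⟩

theorem theoremt (f : ℤ[X]) (hf : IsNormalizedIrreducible f) (hnonhyp : IsNonhyperbolic f)
    (hnoncyc : ¬ IsCyclotomic f)
    (ν : Measure BddIntSeq) [IsProbabilityMeasure ν] (hν : MeasurePreserving (shiftInt 1) ν ν) :
    List.TFAE [
      ∃ νt : Measure (YTilde f), IsProbabilityMeasure νt ∧
        MeasurePreserving (sigmaTilde f) νt νt ∧ νt.map Prod.fst = ν,
      ∀ ε : ℝ, 0 < ε → ∃ C : Set (W0 f), IsCompact C ∧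
        ∀ k : ℤ, 1 - ε < ν.real {v | cocycle f k v ∈ C},
      ∃ b : BddIntSeq → W0 f, Measurable b ∧
        ∀ᵐ v ∂ν, cocycle f 1 v = b (shiftInt 1 v) - shiftW0 f (b v)] ∧
    ∀ b : BddIntSeq → W0 f, Measurable b →
      (∀ᵐ v ∂ν, cocycle f 1 v = b (shiftInt 1 v) - shiftW0 f (b v)) →
      Measurable (xiStarB hf b) ∧
      (∀ v, xiStarB hf b v - xiStar hf v ∈ X0 f) ∧
      (∀ᵐ v ∂ν, xiStarB hf b (shiftInt 1 v) = alpha f (xiStarB hf b v)) ∧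
      IsProbabilityMeasure (ν.map (xiStarB hf b)) ∧
      MeasurePreserving (alpha f) (ν.map (xiStarB hf b)) (ν.map (xiStarB hf b)) :=
  theoremt_general f hf ν hν
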